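/- **Conventions.** A *regular category* has finite limits and coequalizers of kernel pairs, and its regular epimorphisms are stable under pullback; a *regular functor* preserves finite limits and regular epimorphisms. A *Heyting category* is a regular category $\mathcal E$ in which every poset $\mathrm{Sub}(X)$ is a Heyting algebra and every inverse image map $f^{-1}:\mathrm{Sub}(Y)\to\mathrm{Sub}(X)$ has a right adjoint $\forall_f$ (a left adjoint $\exists_f$ exists by regularity). Subobjects $U,V$ of $X$ *intersect* if $U\wedge V\to 1$ is a regular epimorphism. Formulas with elements are read in the internal language. An *ordered partial applicative structure* (OPAS) in $\mathcal E$ is an object $A$ with a partial order $\le$ and a monotone partial binary operation $(x,y)\mapsto xy$ (application) with downward closed domain; $xy\downarrow z$ means that $xy$ is defined and equals $z$. The *partial combinatory arrows* $A^n\rightharpoonup A$ are those generated from the projections by pointwise application. An element $a$ *represents* $f:A^n\rightharpoonup A$ if for all $x_1,\dots,x_n$ the applications $ax_1,\ \dots,\ ((ax_1)\dots)x_{n-1}$ are defined and, whenever $f(\vec x)$ is defined, $((ax_1)\dots)x_n$ is defined and $\le f(\vec x)$. An *OPCA pair* $(A',A)$ is an OPAS $A$ with a subobject $A'\le A$ that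 is closed under application, such that for every partial combinatory arrow $f$ of $A$ the subobject $\{a\in A\mid a\text{ represents }f\}$ intersects $A'$. Let $(A',A)$ be an OPCA pair in $\mathcal E$ and $F:\mathcal E\to\mathcal C$ a regular functor to a regular category. An *$F$-filter* is a subobject $C\le FA$ such that: if $x\in C$ and $x\le y$ then $y\in C$; if $x,y\in C$ and $xy\downarrow z$ then $z\in C$; and if $U\le A$ intersects $A'$ then $FU$ intersects $C$. (Here $FA$ has the order and the application that are the images under $F$ of those of $A$.) A *regular model* is such a pair $(F,C)$. A *morphism* $(F:\mathcal E\to\mathcal C,\,C)\to(G:\mathcal E\to\mathcal D,\,D)$ is a regular functor $H:\mathcal C\to\mathcal D$ with a natural isomorphism $\eta:HF\to G$ such that $\eta_A$ restricts to an isomorphism between $HC$ and $D$. An *assembly* is a pair $(X,Y)$ with $X\in\mathcal E$ and $Y\le A\times X$ such that every $x\in X$ has an $a\in A$ with $(a,x)\in Y$, and $(a,x)\in Y$, $b\le a$ imply $(b,x)\in Y$. A morphism $(X,Y)\to(X',Y')$ is an arrow $f:X\to X'$ for which there is a subobject $V\le A$ that intersects $A'$ such that for $a\in V$ and $(b,x)\in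 Y$ the application $ab$ is defined and $(ab,f(x))\in Y'$. With composition as in $\mathcal E$, these form the category $\mathrm{Asm}(A',A)$. Let $\nabla:\mathcal E\to\mathrm{Asm}(A',A)$ be the functor $\nabla X=(X,A\times X)$, $\nabla f=f$, and let $\mathring A=(A,\{(a,x)\mid a\le x\})$, a subobject of $\nabla A$ by the identity of $A$. **Theorem.** For every Heyting category $\mathcal E$ and every OPCA pair $(A',A)$ in $\mathcal E$, the category $\mathrm{Asm}(A',A)$ is regular, $\nabla$ is a regular functor, $\mathring A$ is a $\nabla$-filter, and the regular model $(\nabla,\mathring A)$ is pseudoinitial among regular models: for every regular model $(F,C)$ there is a morphism $(F_C,\eta):(\nabla,\mathring A)\to(F,C)$ (so $F_C\nabla\cong F$ and this isomorphism identifies $F_C\mathring A$ with $C$), and for any two such morphisms $(H,\eta)$ and $(H',\eta')$ there is exactly one natural isomorphism $\theta:H\to H'$ with $\eta'\circ\theta\nabla=\eta$. -/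

import Mathlib

open CategoryTheory CategoryTheory.Limits

universe v u v₁ u₁ v₂ u₂

namespace RelReal

/-- A *Heyting category*: a regular category in which every poset `Sub(X)` is a Heyting algebra
(top and meets exist in any category with finite limits) and every inverse image map has a right
adjoint `∀_f`.  The left adjoints `∃_f` are given by regularity. -/
class HeytingCategory (E : Type u) [Category.{v} E] : Prop extends Regular E where
  exists_bot (X : E) : ∃ B : Subobject X, IsLeast Set.univ B
  exists_sup {X : E} (P Q : Subobject X) : ∃ S : Subobject X, IsLUB {P, Q} S
  exists_himp {X : E} (P Q : Subobject X) : ∃ S : Subobject X, ∀ R, R ≤ S ↔ R ⊓ P ≤ Q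
  exists_forall {X Y : E} (f : X ⟶ Y) :
    ∃ g : Subobject X → Subobject Y, GaloisConnection (Subobject.pullback f).obj g

/-- A *regular functor* preserves finite limits and regular epimorphisms. -/
class RegularFunctor {C : Type u₁} [Category.{v₁} C] {D : Type u₂} [Category.{v₂} D]
    (F : C ⥤ D) : Prop extends PreservesFiniteLimits F where
  map_regularEpi {X Y : C} (f : X ⟶ Y) : IsRegularEpi f → IsRegularEpi (F.map f)

/-- Two subobjects *intersect* if their meet is inhabited, i.e. its support is terminal. -/
def Intersects {C : Type u} [Category.{v} C] [HasFiniteLimits C] {X : C}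
    (P Q : Subobject X) : Prop :=
  IsRegularEpi (terminal.from ((P ⊓ Q : Subobject X) : C))

/-- Partial arrows `X ⇀ Y`: an arrow to `Y` defined on a subobject of `X`. -/
structure PartialArrow {C : Type u} [Category.{v} C] (X Y : C) where
  dom : Subobject X
  hom : (dom : C) ⟶ Y

namespace PartialArrow

variable {C : Type u} [Category.{v} C] {X Y : C}

/-- `f.At x y`, for generalized elements `x`, `y`: the partial arrow `f` is defined at `x`, with
value `y`. -/
def At (f : PartialArrow X Y) {I : C} (x : I ⟶ X) (y : I ⟶ Y) : Prop :=
  ∃ r : I ⟶ (f.dom : C), r ≫ f.dom.arrow = x ∧ r ≫ f.hom = y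

/-- A total arrow as a partial one. -/
noncomputable def ofHom (f : X ⟶ Y) : PartialArrow X Y where
  dom := ⊤
  hom := (⊤ : Subobject X).arrow ≫ f

end PartialArrow

/-! Internal formulas are interpreted through generalized elements: `P.Factors x`, for
`x : I ⟶ X`, says that `x` belongs to the subobject `P` of `X`. -/

/-- An *ordered partial applicative structure*: an object with a partial order and a monotone
partial binary operation whose domain is downward closed. -/
structure OPAS (E : Type u) [Category.{v} E] [HasFiniteLimits E] where
  carrier : E
  le : Subobject (carrier ⨯ carrier)
  app : PartialArrow (carrier ⨯ carrier) carrier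
  le_refl {I : E} (a : I ⟶ carrier) : le.Factors (prod.lift a a)
  le_trans {I : E} (a b c : I ⟶ carrier) :
    le.Factors (prod.lift a b) → le.Factors (prod.lift b c) → le.Factors (prod.lift a c)
  le_antisymm {I : E} (a b : I ⟶ carrier) :
    le.Factors (prod.lift a b) → le.Factors (prod.lift b a) → a = b
  app_mono {I : E} (a b c d e : I ⟶ carrier) :
    le.Factors (prod.lift a b) → le.Factors (prod.lift c d) → app.At (prod.lift b d) e →
      ∃ f : I ⟶ carrier, app.At (prod.lift a c) f ∧ le.Factors (prod.lift f e)

namespace OPAS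

variable {E : Type u} [Category.{v} E] [HasFiniteLimits E] (A : OPAS E)

/-- `a ≤ b`. -/
def Le {I : E} (a b : I ⟶ A.carrier) : Prop := A.le.Factors (prod.lift a b)

/-- `ab ↓ c`: the application of `a` to `b` is defined and equal to `c`. -/
def App {I : E} (a b c : I ⟶ A.carrier) : Prop := A.app.At (prod.lift a b) c

/-- `Apps a [x₁, …, xₙ] z`: the iterated application `((a x₁) …) xₙ` is defined and equal
to `z`. -/
def Apps {I : E} : (I ⟶ A.carrier) → List (I ⟶ A.carrier) → (I ⟶ A.carrier) → Prop
  | a, [], z => a = z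
  | a, x :: xs, z => ∃ y, A.App a x y ∧ Apps y xs z

/-- The power `Aⁿ`. -/
noncomputable def pow (n : ℕ) : E := ∏ᶜ fun _ : Fin n => A.carrier

/-- The projections of `Aⁿ`. -/
noncomputable def proj {n : ℕ} (i : Fin n) : A.pow n ⟶ A.carrier :=
  Pi.π (fun _ : Fin n => A.carrier) i

/-- The components `[x₁, …, xₙ]` of an element of `Aⁿ`. -/
noncomputable def args {n : ℕ} {I : E} (x : I ⟶ A.pow n) : List (I ⟶ A.carrier) :=
  List.ofFn fun i => x ≫ A.proj i

/-- The pointwise application `x ↦ s(x) t(x)` of two partial arrows, defined at those `x` in both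
domains for which `(s(x), t(x))` is in the domain of the application. -/
noncomputable def pointwiseApp {X : E} (s t : PartialArrow X A.carrier) :
    PartialArrow X A.carrier :=
  let st : pullback s.dom.arrow t.dom.arrow ⟶ A.carrier ⨯ A.carrier :=
    prod.lift (pullback.fst _ _ ≫ s.hom) (pullback.snd _ _ ≫ t.hom)
  let i : pullback st A.app.dom.arrow ⟶ X :=
    pullback.fst st A.app.dom.arrow ≫ pullback.fst s.dom.arrow t.dom.arrow ≫ s.dom.arrow
  { dom := Subobject.mk i
    hom := (Subobject.underlyingIso i).hom ≫ pullback.snd st A.app.dom.arrow ≫ A.app.hom }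

/-- The *partial combinatory arrows*: the least class of partial arrows `Aⁿ ⇀ A` that contains
the projections and is closed under pointwise application. -/
inductive IsCombinatory {n : ℕ} : PartialArrow (A.pow n) A.carrier → Prop
  | proj (i : Fin n) : IsCombinatory (PartialArrow.ofHom (A.proj i))
  | app (s t : PartialArrow (A.pow n) A.carrier) :
      IsCombinatory s → IsCombinatory t → IsCombinatory (A.pointwiseApp s t)

/-- All elements `a` of `V` *represent* the partial arrow `f : Aⁿ ⇀ A`: the applications
`a x₁`, …, `((a x₁) …) xₙ₋₁` are defined for all `(x₁, …, xₙ)`, and `((a x₁) …) xₙ` is defined and below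
`f(x₁, …, xₙ)` for all `(x₁, …, xₙ)` in the domain of `f`. In other words, `V` is contained in the
object of realizers of `f`. -/
def Represents {n : ℕ} (V : Subobject A.carrier) (f : PartialArrow (A.pow n) A.carrier) : Prop :=
  ∀ ⦃I : E⦄ (a : I ⟶ A.carrier) (x : I ⟶ A.pow n), V.Factors a →
    (∃ z, A.Apps a (A.args x).dropLast z) ∧
      ∀ y, f.At x y → ∃ z, A.Apps a (A.args x) z ∧ A.Le z y

end OPAS

/-- An *OPCA pair* `(A', A)`: an OPAS `A` with a subobject `sub` (that is, `A'`) which is closed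
under the application of `A`, such that for every partial combinatory arrow of `A` the object of
its realizers in `A` (the largest `V` that represents it) intersects `A'`. -/
structure OPCAPair (E : Type u) [Category.{v} E] [HasFiniteLimits E] where
  A : OPAS E
  sub : Subobject A.carrier
  closed {I : E} (x y z : I ⟶ A.carrier) :
    sub.Factors x → sub.Factors y → A.App x y z → sub.Factors z
  complete {n : ℕ} (f : PartialArrow (A.pow n) A.carrier) : A.IsCombinatory f →
    ∃ V : Subobject A.carrier, A.Represents V f ∧ Intersects V sub

section Assemblies

variable {E : Type u} [Category.{v} E] [HasFiniteLimits E] (P : OPCAPair E)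

/-- An *assembly* `(X, Y)`: an object `X` and a subobject `Y` of `A × X` which is total over `X`
and downward closed in `A`. -/
structure Asm where
  X : E
  Y : Subobject (P.A.carrier ⨯ X)
  total : IsRegularEpi (Y.arrow ≫ prod.snd)
  down {I : E} (a b : I ⟶ P.A.carrier) (x : I ⟶ X) :
    Y.Factors (prod.lift a x) → P.A.Le b a → Y.Factors (prod.lift b x)

variable {P}

/-- `V` *tracks* `f : X ⟶ X'`: if `a ∈ V` and `(b, x) ∈ Y`, then `ab ↓` and `(ab, f(x)) ∈ Y'`. -/
def Tracks (S T : Asm P) (V : Subobject P.A.carrier) (f : S.X ⟶ T.X) : Prop :=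
  ∀ ⦃I : E⦄ (a b : I ⟶ P.A.carrier) (x : I ⟶ S.X), V.Factors a → S.Y.Factors (prod.lift b x) →
    ∃ c, P.A.App a b c ∧ T.Y.Factors (prod.lift c (x ≫ f))

/-- `f` is tracked by some subobject of `A` that intersects `A'`. -/
def IsTracked (S T : Asm P) (f : S.X ⟶ T.X) : Prop :=
  ∃ V : Subobject P.A.carrier, Intersects V P.sub ∧ Tracks S T V f

end Assemblies

section Category

variable {E : Type u} [Category.{v} E]

theorem PartialArrow.at_ofHom {X Y I : E} (f : X ⟶ Y) (x : I ⟶ X) (y : I ⟶ Y) :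
    (PartialArrow.ofHom f).At x y ↔ x ≫ f = y := by
  constructor
  · rintro ⟨r, rfl, rfl⟩
    exact Category.assoc r (⊤ : Subobject X).arrow f
  · rintro rfl
    refine ⟨(⊤ : Subobject X).factorThru x (Subobject.top_factors x),
      Subobject.factorThru_arrow _ _ _, ?_⟩
    change _ ≫ (⊤ : Subobject X).arrow ≫ f = _
    rw [← Category.assoc, Subobject.factorThru_arrow]

theorem PartialArrow.At.comp {X Y I J : E} {f : PartialArrow X Y} {x : I ⟶ X} {y : I ⟶ Y}
    (h : f.At x y) (p : J ⟶ I) : f.At (p ≫ x) (p ≫ y) := by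
  obtain ⟨r, rfl, rfl⟩ := h
  exact ⟨p ≫ r, by simp, by simp⟩

theorem PartialArrow.At.unique {X Y I : E} {f : PartialArrow X Y} {x : I ⟶ X} {y z : I ⟶ Y}
    (h : f.At x y) (k : f.At x z) : y = z := by
  obtain ⟨r, hr, rfl⟩ := h
  obtain ⟨s, hs, rfl⟩ := k
  rw [(cancel_mono f.dom.arrow).1 (hr.trans hs.symm)]

theorem factors_comp {X I J : E} {P : Subobject X} {x : I ⟶ X} (h : P.Factors x) (p : J ⟶ I) :
    P.Factors (p ≫ x) := Subobject.factors_of_factors_right p h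

/-- Membership in a subobject is local for covers. -/
theorem factors_of_cover {X I J : E} {P : Subobject X} {x : I ⟶ X} (p : J ⟶ I) [StrongEpi p]
    (h : P.Factors (p ≫ x)) : P.Factors x := by
  have sq : CommSq (P.factorThru _ h) p P.arrow x := ⟨by simp⟩
  exact (Subobject.factors_iff _ _).2 ⟨sq.lift, sq.fac_right⟩

theorem OPAS.at_pointwiseApp [HasFiniteLimits E] (A : OPAS E) {X I : E}
    (s t : PartialArrow X A.carrier) (x : I ⟶ X) {y z w : I ⟶ A.carrier}
    (hs : s.At x y) (ht : t.At x z) (h : A.App y z w) : (A.pointwiseApp s t).At x w := by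
  obtain ⟨r, hr, rfl⟩ := hs
  obtain ⟨q, hq, rfl⟩ := ht
  obtain ⟨p, hp, rfl⟩ := h
  refine ⟨pullback.lift (pullback.lift r q (hr.trans hq.symm)) p ?_ ≫
    (Subobject.underlyingIso _).inv, ?_, ?_⟩
  · rw [hp, prod.comp_lift, pullback.lift_fst_assoc, pullback.lift_snd_assoc]
  · unfold OPAS.pointwiseApp
    dsimp only
    rw [Category.assoc, Subobject.underlyingIso_arrow, pullback.lift_fst_assoc,
      pullback.lift_fst_assoc, hr]
  · unfold OPAS.pointwiseApp
    dsimp only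
    rw [Category.assoc, Iso.inv_hom_id_assoc, pullback.lift_snd_assoc]

theorem OPAS.exists_tuple [HasFiniteLimits E] (A : OPAS E) {n : ℕ} {I : E}
    (xs : Fin n → (I ⟶ A.carrier)) : ∃ x : I ⟶ A.pow n, ∀ i, x ≫ A.proj i = xs i :=
  ⟨Pi.lift xs, fun i => Pi.lift_π xs i⟩

variable [Regular E]

theorem isRegularEpi_of_strongEpi {X Y : E} (f : X ⟶ Y) [StrongEpi f] : IsRegularEpi f :=
  inferInstance

theorem intersects_of_cover {X T : E} {P Q : Subobject X} (r : T ⟶ X) (hP : P.Factors r)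
    (hQ : Q.Factors r) [StrongEpi (terminal.from T)] : Intersects P Q := by
  have h : (P ⊓ Q).Factors r := (Subobject.inf_factors _).2 ⟨hP, hQ⟩
  have : StrongEpi ((P ⊓ Q).factorThru r h ≫ terminal.from _) := by
    rwa [terminal.comp_from]
  have := strongEpi_of_strongEpi ((P ⊓ Q).factorThru r h) (terminal.from _)
  exact isRegularEpi_of_strongEpi _

/-- An element of an intersection exists on a cover of the terminal object. -/
theorem Intersects.exists_cover {X : E} {P Q : Subobject X} (h : Intersects P Q) :
    ∃ (T : E) (r : T ⟶ X), StrongEpi (terminal.from T) ∧ P.Factors r ∧ Q.Factors r := by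
  have : IsRegularEpi _ := h
  exact ⟨_, (P ⊓ Q).arrow, inferInstance,
    ((Subobject.inf_factors _).1 (Subobject.factors_self _)).1,
    ((Subobject.inf_factors _).1 (Subobject.factors_self _)).2⟩

theorem strongEpi_fst {S T : E} [StrongEpi (terminal.from T)] :
    StrongEpi (prod.fst : S ⨯ T ⟶ S) := by
  have : IsRegularEpi (terminal.from T) := isRegularEpi_of_strongEpi _
  have h : IsPullback (prod.snd : S ⨯ T ⟶ T) prod.fst (terminal.from T) (terminal.from S) :=
    (IsPullback.of_hasBinaryProduct' S T).flip
  have : IsRegularEpi (prod.fst : S ⨯ T ⟶ S) :=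
    Regular.regularEpiIsStableUnderBaseChange.of_isPullback h this
  infer_instance

theorem strongEpi_snd {S T : E} [StrongEpi (terminal.from S)] :
    StrongEpi (prod.snd : S ⨯ T ⟶ T) := by
  have := strongEpi_fst (S := T) (T := S)
  have e : (prod.snd : S ⨯ T ⟶ T) = (prod.braiding S T).hom ≫ prod.fst :=
    (prod.lift_fst _ _).symm
  rw [e]
  exact strongEpi_comp _ _

theorem strongEpi_prod {S T : E} [StrongEpi (terminal.from S)] [StrongEpi (terminal.from T)] :
    StrongEpi (terminal.from (S ⨯ T)) := by
  have := strongEpi_fst (S := S) (T := T)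
  rw [← terminal.comp_from (prod.fst : S ⨯ T ⟶ S)]
  exact strongEpi_comp _ _

variable {P : OPCAPair E}

/-- An arrow that respects realizers is tracked, by the realizers of the identity. -/
theorem isTracked_of_le (S T : Asm P) (f : S.X ⟶ T.X)
    (hf : ∀ ⦃I : E⦄ (b : I ⟶ P.A.carrier) (x : I ⟶ S.X), S.Y.Factors (prod.lift b x) →
      T.Y.Factors (prod.lift b (x ≫ f))) : IsTracked S T f := by
  obtain ⟨V, hV, hi⟩ := P.complete _ (OPAS.IsCombinatory.proj (A := P.A) (0 : Fin 1))
  refine ⟨V, hi, fun I a b x ha hb => ?_⟩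
  obtain ⟨t, ht⟩ := P.A.exists_tuple (n := 1) fun _ => b
  obtain ⟨z, hz, hle⟩ := (hV a t ha).2 b ((PartialArrow.at_ofHom _ _ _).2 (ht 0))
  simp only [OPAS.args, ht, List.ofFn_succ, List.ofFn_zero, OPAS.Apps] at hz
  obtain ⟨c, hc, rfl⟩ := hz
  exact ⟨c, hc, T.down _ _ _ (hf b x hb) hle⟩

theorem isTracked_comp (S T W : Asm P) (f : S.X ⟶ T.X) (g : T.X ⟶ W.X)
    (hf : IsTracked S T f) (hg : IsTracked T W g) : IsTracked S W (f ≫ g) := by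
  obtain ⟨U, hU, tU⟩ := hf
  obtain ⟨V, hV, tV⟩ := hg
  obtain ⟨B, rB, hB⟩ := P.complete _
    (.app _ _ (OPAS.IsCombinatory.proj (A := P.A) (0 : Fin 3))
      (.app _ _ (.proj (1 : Fin 3)) (.proj (2 : Fin 3))))
  obtain ⟨T₁, b, _, hb, hb'⟩ := hB.exists_cover
  obtain ⟨T₂, v, _, hv, hv'⟩ := hV.exists_cover
  obtain ⟨T₃, u, _, hu, hu'⟩ := hU.exists_cover
  have := strongEpi_prod (S := T₂) (T := T₃)
  have := strongEpi_prod (S := T₁) (T := T₂ ⨯ T₃)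
  let b₁ : T₁ ⨯ (T₂ ⨯ T₃) ⟶ P.A.carrier := prod.fst ≫ b
  let v₁ : T₁ ⨯ (T₂ ⨯ T₃) ⟶ P.A.carrier := (prod.snd ≫ prod.fst) ≫ v
  let u₁ : T₁ ⨯ (T₂ ⨯ T₃) ⟶ P.A.carrier := (prod.snd ≫ prod.snd) ≫ u
  have hb₁ : B.Factors b₁ := factors_comp hb _
  have hv₁ : V.Factors v₁ := factors_comp hv _
  have hu₁ : U.Factors u₁ := factors_comp hu _
  obtain ⟨t₀, ht₀⟩ := P.A.exists_tuple ![v₁, u₁, u₁]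
  obtain ⟨r, hr⟩ := (rB b₁ t₀ hb₁).1
  simp only [OPAS.args, ht₀, List.ofFn_succ, List.ofFn_zero, OPAS.Apps, List.dropLast] at hr
  obtain ⟨r₁, h₁, r₂, h₂, rfl⟩ := hr
  refine ⟨Subobject.mk (image.ι r₂), intersects_of_cover r₂ ?_ ?_, ?_⟩
  · exact (Subobject.mk_factors_iff _ _).2 ⟨factorThruImage r₂, image.fac r₂⟩
  · refine P.closed _ _ _ (P.closed _ _ _ (factors_comp hb' _) ?_ h₁) ?_ h₂
    · exact factors_comp hv' _
    · exact factors_comp hu' _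
  · intro I a w x ha hw
    obtain ⟨k, hk⟩ := (Subobject.mk_factors_iff _ _).1 ha
    dsimp at k hk
    have hreg : IsRegularEpi (factorThruImage r₂) := isRegularEpi_of_strongEpi _
    let q := pullback.fst k (factorThruImage r₂)
    let t := pullback.snd k (factorThruImage r₂)
    have hq : StrongEpi q := by
      have : IsRegularEpi q := inferInstance
      infer_instance
    have hqa : q ≫ a = t ≫ r₂ := by
      rw [← hk, ← Category.assoc, pullback.condition, Category.assoc, image.fac]
    have hqw : S.Y.Factors (prod.lift (q ≫ w) (q ≫ x)) := by
      rw [← prod.comp_lift]; exact factors_comp hw q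
    obtain ⟨c, hc, hcY⟩ := tU (t ≫ u₁) (q ≫ w) (q ≫ x) (factors_comp hu₁ t) hqw
    obtain ⟨d, hd, hdY⟩ := tV (t ≫ v₁) c _ (factors_comp hv₁ t) hcY
    obtain ⟨t₁, ht₁⟩ := P.A.exists_tuple ![t ≫ v₁, t ≫ u₁, q ≫ w]
    obtain ⟨e, he, hle⟩ := (rB (t ≫ b₁) t₁ (factors_comp hb₁ t)).2 d (by
        refine OPAS.at_pointwiseApp _ _ _ _ ((PartialArrow.at_ofHom _ _ _).2 rfl)
          (OPAS.at_pointwiseApp _ _ _ _ ((PartialArrow.at_ofHom _ _ _).2 rfl)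
            ((PartialArrow.at_ofHom _ _ _).2 rfl) (w := c) ?_) ?_
        · rw [ht₁, ht₁]; exact hc
        · rw [ht₁]; exact hd)
    simp only [OPAS.args, ht₁, List.ofFn_succ, List.ofFn_zero, OPAS.Apps] at he
    obtain ⟨e₁, he₁, e₂, he₂, e₃, he₃, rfl⟩ := he
    have h₁' : P.A.App (t ≫ b₁) (t ≫ v₁) (t ≫ r₁) := by
      have := h₁.comp t
      rwa [prod.comp_lift] at this
    obtain rfl : t ≫ r₁ = e₁ := h₁'.unique he₁
    have h₂' : P.A.App (t ≫ r₁) (t ≫ u₁) (t ≫ r₂) := by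
      have := h₂.comp t
      rwa [prod.comp_lift] at this
    obtain rfl : t ≫ r₂ = e₂ := h₂'.unique he₂
    -- descend the value of the application along the cover `q`
    have hdom : P.A.app.dom.Factors (prod.lift a w) := by
      refine factors_of_cover q ?_
      obtain ⟨m, hm, -⟩ := he₃
      refine (Subobject.factors_iff _ _).2 ⟨m, ?_⟩
      rw [prod.comp_lift, hqa]
      exact hm
    have happ : P.A.App a w (P.A.app.dom.factorThru _ hdom ≫ P.A.app.hom) := ⟨_, by simp, rfl⟩
    refine ⟨_, happ, factors_of_cover q ?_⟩
    have happ' := happ.comp q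
    rw [prod.comp_lift, hqa] at happ'
    have hval := happ'.unique he₃
    rw [prod.comp_lift, hval]
    have := W.down _ _ _ hdY hle
    simpa using this

/-- The category `Asm(A', A)` of assemblies: the morphisms `(X, Y) ⟶ (X', Y')` are the arrows
`X ⟶ X'` that are tracked by some subobject of `A` that intersects `A'`. -/
instance : Category (Asm P) where
  Hom S T := { f : S.X ⟶ T.X // IsTracked S T f }
  id S := ⟨𝟙 S.X, isTracked_of_le _ _ _ fun _ _ _ h => by simpa using h⟩
  comp f g := ⟨f.1 ≫ g.1, isTracked_comp _ _ _ _ _ f.2 g.2⟩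
  id_comp f := Subtype.ext (Category.id_comp f.1)
  comp_id f := Subtype.ext (Category.comp_id f.1)
  assoc f g h := Subtype.ext (Category.assoc f.1 g.1 h.1)

variable (P)

theorem strongEpi_carrier : StrongEpi (terminal.from P.A.carrier) := by
  obtain ⟨V, -, hi⟩ := P.complete _ (OPAS.IsCombinatory.proj (A := P.A) (0 : Fin 1))
  obtain ⟨T, r, _, -⟩ := hi.exists_cover
  have : StrongEpi (r ≫ terminal.from P.A.carrier) := by rwa [terminal.comp_from]
  exact strongEpi_of_strongEpi r _

/-- The functor `∇ : E ⥤ Asm(A', A)`, `∇ X = (X, A × X)`, `∇ f = f`. -/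
noncomputable def nabla : E ⥤ Asm P where
  obj X :=
    { X := X
      Y := ⊤
      total := by
        have := strongEpi_carrier P
        have := strongEpi_snd (S := P.A.carrier) (T := X)
        have : StrongEpi ((⊤ : Subobject (P.A.carrier ⨯ X)).arrow ≫ prod.snd) :=
          strongEpi_comp _ _
        exact isRegularEpi_of_strongEpi _
      down := fun _ _ _ _ _ => Subobject.top_factors _ }
  map f := ⟨f, isTracked_of_le _ _ _ fun _ _ _ _ => Subobject.top_factors _⟩
  map_id _ := rfl
  map_comp _ _ := rfl

/-- The assembly `Å = (A, {(a, x) | a ≤ x})`. -/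
def ringAsm : Asm P where
  X := P.A.carrier
  Y := P.A.le
  total := by
    have : IsSplitEpi (P.A.le.arrow ≫ (prod.snd : P.A.carrier ⨯ P.A.carrier ⟶ _)) :=
      ⟨⟨P.A.le.factorThru _ (P.A.le_refl (𝟙 _)), by
        rw [← Category.assoc, Subobject.factorThru_arrow, prod.lift_snd]⟩⟩
    exact isRegularEpi_of_strongEpi _
  down a b x h k := P.A.le_trans b a x k h

/-- The inclusion `Å ⟶ ∇ A`, whose underlying arrow is the identity of `A`. -/
def ringι : ringAsm P ⟶ (nabla P).obj P.A.carrier :=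
  ⟨𝟙 P.A.carrier, isTracked_of_le _ _ _ fun _ _ _ _ => Subobject.top_factors _⟩

instance : Mono (ringι P) where
  right_cancellation f g h := by
    have h' : f.1 ≫ 𝟙 P.A.carrier = g.1 ≫ 𝟙 P.A.carrier := congrArg Subtype.val h
    exact Subtype.ext ((Category.comp_id f.1).symm.trans (h'.trans (Category.comp_id g.1)))

/-- `Å` as a subobject of `∇ A`. -/
noncomputable def ring : Subobject ((nabla P).obj P.A.carrier) := Subobject.mk (ringι P)

end Category

section Models

variable {E : Type u} [Category.{v} E] [HasFiniteLimits E]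

/-- An *`F`-filter* for a regular functor `F : E ⥤ C`: a subobject `D` of `F A` which is upward
closed for the order `F(≤)`, closed under the partial application of `F A`, and which intersects
`F U` for every subobject `U` of `A` that intersects `A'`. -/
structure IsFilter (P : OPCAPair E) {C : Type u₁} [Category.{v₁} C] [Regular C]
    (F : E ⥤ C) [RegularFunctor F] (D : Subobject (F.obj P.A.carrier)) : Prop where
  up {I : C} (x y : I ⟶ F.obj P.A.carrier) : D.Factors x →
    (∃ r : I ⟶ F.obj (P.A.le : E), r ≫ F.map (P.A.le.arrow ≫ prod.fst) = x ∧
      r ≫ F.map (P.A.le.arrow ≫ prod.snd) = y) → D.Factors y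
  app {I : C} (x y z : I ⟶ F.obj P.A.carrier) : D.Factors x → D.Factors y →
    (∃ r : I ⟶ F.obj (P.A.app.dom : E), r ≫ F.map (P.A.app.dom.arrow ≫ prod.fst) = x ∧
      r ≫ F.map (P.A.app.dom.arrow ≫ prod.snd) = y ∧ r ≫ F.map P.A.app.hom = z) → D.Factors z
  inter (U : Subobject P.A.carrier) : Intersects U P.sub →
    Intersects (Subobject.mk (F.map U.arrow)) D

/-- A *regular model* of `(A', A)`: a regular functor `F : E ⥤ C` to a regular category together
with an `F`-filter. -/
structure RegularModel (P : OPCAPair E) where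
  C : Type u₁
  [category : Category.{v₁} C]
  [regular : Regular C]
  F : E ⥤ C
  [regularFunctor : RegularFunctor F]
  filter : Subobject (F.obj P.A.carrier)
  isFilter : IsFilter P F filter

attribute [instance] RegularModel.category RegularModel.regular RegularModel.regularFunctor

/-- A *morphism of regular models* `(F, C) ⟶ (G, D)`: a regular functor `H` with an isomorphism
`η : H F ≅ G` whose component at `A` restricts to an isomorphism between `H C` and `D`. -/
structure RegularModel.Hom {P : OPCAPair E} (M : RegularModel.{v, u, v₁, u₁} P)
    (N : RegularModel.{v, u, v₂, u₂} P) where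
  H : M.C ⥤ N.C
  [regularFunctor : RegularFunctor H]
  η : M.F ⋙ H ≅ N.F
  map_filter : Subobject.mk (H.map M.filter.arrow ≫ η.hom.app P.A.carrier) = N.filter

/-- A regular model is *pseudoinitial* if it has an essentially unique morphism to every regular
model: there is one, and any two are isomorphic, by a unique isomorphism of functors that is
compatible with the isomorphisms `η`. -/
def RegularModel.IsPseudoinitial {P : OPCAPair E} (M : RegularModel.{v, u, v₁, u₁} P) : Prop :=
  ∀ N : RegularModel.{v, u, v₂, u₂} P, Nonempty (M.Hom N) ∧
    ∀ K L : M.Hom N, ∃! θ : K.H ≅ L.H,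
      ∀ X : E, θ.hom.app (M.F.obj X) ≫ L.η.hom.app X = K.η.hom.app X

end Models

end RelReal

namespace RelReal

section Covers

variable {C : Type u} [Category.{v} C]

theorem strongEpi_of_lift {X Y J : C} (f : X ⟶ Y) (q : J ⟶ Y) [StrongEpi q] (x : J ⟶ X)
    (h : x ≫ f = q) : StrongEpi f := by
  have : StrongEpi (x ≫ f) := by rwa [h]
  exact strongEpi_of_strongEpi x f

theorem PartialArrow.exists_at_of_cover {X Y I J : C} {f : PartialArrow X Y} {x : I ⟶ X}
    (q : J ⟶ I) [StrongEpi q] {y : J ⟶ Y} (h : f.At (q ≫ x) y) :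
    ∃ z, f.At x z ∧ q ≫ z = y := by
  have hd : f.dom.Factors x := by
    obtain ⟨m, hm, -⟩ := h
    exact factors_of_cover q ((Subobject.factors_iff _ _).2 ⟨m, hm⟩)
  have hx : f.At x (f.dom.factorThru x hd ≫ f.hom) := ⟨_, by simp, rfl⟩
  exact ⟨_, hx, (hx.comp q).unique h⟩

theorem mk_factors_iff' {X Y I : C} (f : X ⟶ Y) [Mono f] (y : I ⟶ Y) :
    (Subobject.mk f).Factors y ↔ ∃ x, x ≫ f = y := by
  rw [Subobject.mk_factors_iff]; rfl

theorem subobject_ext {X : C} {U V : Subobject X}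
    (h : ∀ ⦃I : C⦄ (x : I ⟶ X), U.Factors x ↔ V.Factors x) : U = V := by
  refine le_antisymm ?_ ?_
  · exact Subobject.le_of_comm (V.factorThru U.arrow ((h _).1 (Subobject.factors_self _)))
      (Subobject.factorThru_arrow _ _ _)
  · exact Subobject.le_of_comm (U.factorThru V.arrow ((h _).2 (Subobject.factors_self _)))
      (Subobject.factorThru_arrow _ _ _)

theorem factors_iff_exists {X I : C} {U : Subobject X} {x : I ⟶ X} :
    U.Factors x ↔ ∃ r : I ⟶ (U : C), r ≫ U.arrow = x :=
  ⟨fun h => ⟨_, U.factorThru_arrow x h⟩, fun h => (Subobject.factors_iff _ _).2 h⟩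

variable [Regular C]

/-- Generalized elements lift along covers, locally. -/
theorem exists_cover_lift {X Y I : C} (e : X ⟶ Y) [StrongEpi e] (y : I ⟶ Y) :
    ∃ (J : C) (q : J ⟶ I) (x : J ⟶ X), StrongEpi q ∧ x ≫ e = q ≫ y := by
  have : IsRegularEpi e := isRegularEpi_of_strongEpi _
  have : IsRegularEpi (pullback.snd e y) := inferInstance
  exact ⟨_, pullback.snd e y, pullback.fst e y, inferInstance, pullback.condition⟩

/-- The image of an arrow, as a subobject of its codomain. -/
noncomputable def imageSub {X Y : C} (f : X ⟶ Y) : Subobject Y := Subobject.mk (image.ι f)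

theorem imageSub_factors_iff {X Y I : C} {f : X ⟶ Y} {y : I ⟶ Y} :
    (imageSub f).Factors y ↔
      ∃ (J : C) (q : J ⟶ I) (x : J ⟶ X), StrongEpi q ∧ x ≫ f = q ≫ y := by
  constructor
  · intro h
    obtain ⟨k, hk⟩ := (Subobject.mk_factors_iff _ _).1 h
    dsimp at k hk
    obtain ⟨J, q, x, hq, e⟩ := exists_cover_lift (factorThruImage f) k
    refine ⟨J, q, x, hq, ?_⟩
    rw [← hk, ← Category.assoc, ← e, Category.assoc, image.fac]
  · rintro ⟨J, q, x, _, e⟩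
    refine factors_of_cover q ((Subobject.mk_factors_iff _ _).2 ⟨x ≫ factorThruImage f, ?_⟩)
    dsimp
    rw [Category.assoc, image.fac, e]

end Covers

namespace OPAS

variable {E : Type u} [Category.{v} E] [HasFiniteLimits E] {A : OPAS E}

theorem Le.comp {I J : E} {a b : I ⟶ A.carrier} (h : A.Le a b) (p : J ⟶ I) :
    A.Le (p ≫ a) (p ≫ b) := by
  have := factors_comp h p
  rwa [prod.comp_lift] at this

theorem Le.refl {I : E} (a : I ⟶ A.carrier) : A.Le a a := A.le_refl a

theorem Le.trans {I : E} {a b c : I ⟶ A.carrier} (h : A.Le a b) (k : A.Le b c) : A.Le a c :=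
  A.le_trans a b c h k

theorem App.comp {I J : E} {a b c : I ⟶ A.carrier} (h : A.App a b c) (p : J ⟶ I) :
    A.App (p ≫ a) (p ≫ b) (p ≫ c) := by
  have := PartialArrow.At.comp h p
  rwa [prod.comp_lift] at this

theorem App.unique {I : E} {a b c d : I ⟶ A.carrier} (h : A.App a b c) (k : A.App a b d) :
    c = d := PartialArrow.At.unique h k

theorem App.mono {I : E} {a b c d e : I ⟶ A.carrier} (h : A.App b d e) (hab : A.Le a b)
    (hcd : A.Le c d) : ∃ f, A.App a c f ∧ A.Le f e := A.app_mono a b c d e hab hcd h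

theorem Apps.comp {I J : E} {a z : I ⟶ A.carrier} {l : List (I ⟶ A.carrier)} (h : A.Apps a l z)
    (p : J ⟶ I) : A.Apps (p ≫ a) (l.map (p ≫ ·)) (p ≫ z) := by
  induction l generalizing a with
  | nil => exact congrArg (p ≫ ·) h
  | cons x l ih =>
    obtain ⟨y, hy, h⟩ := h
    exact ⟨_, App.comp hy p, ih h⟩

theorem Apps.unique {I : E} {a z w : I ⟶ A.carrier} {l : List (I ⟶ A.carrier)}
    (h : A.Apps a l z) (k : A.Apps a l w) : z = w := by
  induction l generalizing a with
  | nil => exact h.symm.trans k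
  | cons x l ih =>
    obtain ⟨y, hy, h⟩ := h
    obtain ⟨y', hy', k⟩ := k
    obtain rfl := hy.unique hy'
    exact ih h k

theorem apps_append {I : E} {a z : I ⟶ A.carrier} {l m : List (I ⟶ A.carrier)} :
    A.Apps a (l ++ m) z ↔ ∃ y, A.Apps a l y ∧ A.Apps y m z := by
  induction l generalizing a with
  | nil => exact ⟨fun h => ⟨a, rfl, h⟩, fun ⟨y, hy, h⟩ => by obtain rfl := hy; exact h⟩
  | cons x l ih =>
    constructor
    · rintro ⟨y, hy, h⟩
      obtain ⟨w, hw, h⟩ := ih.1 h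
      exact ⟨w, ⟨y, hy, hw⟩, h⟩
    · rintro ⟨w, ⟨y, hy, hw⟩, h⟩
      exact ⟨y, hy, ih.2 ⟨w, hw, h⟩⟩

end OPAS

namespace OPAS

variable {E : Type u} [Category.{v} E] [Regular E] {A : OPAS E}

theorem exists_app_of_cover {I J : E} {a b : I ⟶ A.carrier} (q : J ⟶ I) [StrongEpi q]
    {c : J ⟶ A.carrier} (h : A.App (q ≫ a) (q ≫ b) c) : ∃ d, A.App a b d ∧ q ≫ d = c := by
  unfold App at h
  rw [← prod.comp_lift] at h
  exact PartialArrow.exists_at_of_cover q h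

theorem le_of_cover {I J : E} {a b : I ⟶ A.carrier} (q : J ⟶ I) [StrongEpi q]
    (h : A.Le (q ≫ a) (q ≫ b)) : A.Le a b := by
  unfold Le at h
  rw [← prod.comp_lift] at h
  exact factors_of_cover q h

theorem exists_apps_of_cover {I J : E} {a : I ⟶ A.carrier} {l : List (I ⟶ A.carrier)}
    (q : J ⟶ I) [StrongEpi q] {c : J ⟶ A.carrier} (h : A.Apps (q ≫ a) (l.map (q ≫ ·)) c) :
    ∃ d, A.Apps a l d := by
  induction l generalizing a with
  | nil => exact ⟨a, rfl⟩
  | cons x l ih =>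
    obtain ⟨y, hy, h⟩ := h
    obtain ⟨w, hw, rfl⟩ := exists_app_of_cover q hy
    obtain ⟨d, hd⟩ := ih h
    exact ⟨d, w, hw, hd⟩

end OPAS

namespace OPCAPair

variable {E : Type u} [Category.{v} E] [Regular E] (P : OPCAPair E)

/-- The pointwise application of two subobjects that intersect `A'` intersects `A'`. -/
theorem exists_app {U V : Subobject P.A.carrier} (hU : Intersects U P.sub)
    (hV : Intersects V P.sub)
    (h : ∀ ⦃I : E⦄ (a b : I ⟶ P.A.carrier), U.Factors a → V.Factors b → ∃ c, P.A.App a b c) :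
    ∃ W : Subobject P.A.carrier, Intersects W P.sub ∧
      ∀ ⦃I : E⦄ (c : I ⟶ P.A.carrier), W.Factors c →
        ∃ (J : E) (q : J ⟶ I) (a b : J ⟶ P.A.carrier), StrongEpi q ∧ U.Factors a ∧
          V.Factors b ∧ P.A.App a b (q ≫ c) := by
  let a₀ : (U : E) ⨯ (V : E) ⟶ P.A.carrier := prod.fst ≫ U.arrow
  let b₀ : (U : E) ⨯ (V : E) ⟶ P.A.carrier := prod.snd ≫ V.arrow
  have ha₀ : U.Factors a₀ := factors_comp (Subobject.factors_self _) _
  have hb₀ : V.Factors b₀ := factors_comp (Subobject.factors_self _) _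
  obtain ⟨c₀, hc₀⟩ := h a₀ b₀ ha₀ hb₀
  refine ⟨imageSub c₀, ?_, ?_⟩
  · obtain ⟨S, a, _, ha, ha'⟩ := hU.exists_cover
    obtain ⟨T, b, _, hb, hb'⟩ := hV.exists_cover
    have := strongEpi_prod (S := S) (T := T)
    have hab := hc₀.comp (prod.lift (prod.fst ≫ U.factorThru a ha) (prod.snd ≫ V.factorThru b hb))
    refine intersects_of_cover _
      (imageSub_factors_iff.2 ⟨_, 𝟙 _, _, inferInstance, (Category.id_comp _).symm⟩)
      (P.closed _ _ _ ?_ ?_ hab)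
    · simpa [a₀] using factors_comp ha' _
    · simpa [b₀] using factors_comp hb' _
  · intro I c hc
    obtain ⟨J, q, x, hq, e⟩ := imageSub_factors_iff.1 hc
    refine ⟨J, q, x ≫ a₀, x ≫ b₀, hq, factors_comp ha₀ _, factors_comp hb₀ _, ?_⟩
    rw [← e]
    exact hc₀.comp x

theorem exists_apps {V : Subobject P.A.carrier} (hV : Intersects V P.sub)
    (l : List (Subobject P.A.carrier)) (hl : ∀ U ∈ l, Intersects U P.sub)
    (h : ∀ ⦃I : E⦄ (a : I ⟶ P.A.carrier) (m : List (I ⟶ P.A.carrier)), V.Factors a →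
      m.length = l.length → ∃ z, P.A.Apps a m z) :
    ∃ W : Subobject P.A.carrier, Intersects W P.sub ∧
      ∀ ⦃I : E⦄ (c : I ⟶ P.A.carrier), W.Factors c →
        ∃ (J : E) (q : J ⟶ I) (a : J ⟶ P.A.carrier) (m : List (J ⟶ P.A.carrier)),
          StrongEpi q ∧ V.Factors a ∧ List.Forall₂ (fun U u => U.Factors u) l m ∧
            P.A.Apps a m (q ≫ c) := by
  induction l generalizing V with
  | nil =>
    exact ⟨V, hV, fun I c hc => ⟨I, 𝟙 I, c, [], inferInstance, hc, .nil,
      (Category.id_comp c).symm⟩⟩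
  | cons U l ih =>
    obtain ⟨W, hW, kW⟩ := P.exists_app hV (hl U (by simp)) fun I a b ha _ => by
      obtain ⟨z, y, hy, -⟩ := h a (b :: List.replicate l.length b) ha (by simp)
      exact ⟨y, hy⟩
    obtain ⟨W', hW', kW'⟩ := ih hW (fun U' h' => hl U' (by simp [h'])) fun I c m hc hm => by
      obtain ⟨J, q, a, b, _, ha, -, hab⟩ := kW c hc
      obtain ⟨z, y, hy, hz⟩ := h a (b :: m.map (q ≫ ·)) ha (by simp [hm])
      obtain rfl := hab.unique hy
      exact OPAS.exists_apps_of_cover q hz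
    refine ⟨W', hW', fun I c hc => ?_⟩
    obtain ⟨J, q, w, m, _, hw, hm, hwm⟩ := kW' c hc
    obtain ⟨K, r, a, b, _, ha, hb, hab⟩ := kW w hw
    refine ⟨K, r ≫ q, a, b :: m.map (r ≫ ·), strongEpi_comp _ _, ha, .cons hb ?_, ?_⟩
    · rw [List.forall₂_map_right_iff]
      exact hm.imp fun _ _ h => factors_comp h _
    · rw [Category.assoc]
      exact ⟨_, hab, hwm.comp r⟩

/-- Realizers of a combinatory arrow in all but one variables, for parameters in subobjects that
intersect `A'`. -/
theorem exists_realizers {m : ℕ} (f : PartialArrow (P.A.pow (m + 1)) P.A.carrier)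
    (hf : P.A.IsCombinatory f) (U : Fin m → Subobject P.A.carrier)
    (hU : ∀ i, Intersects (U i) P.sub) :
    ∃ W : Subobject P.A.carrier, Intersects W P.sub ∧
      ∀ ⦃I : E⦄ (c : I ⟶ P.A.carrier), W.Factors c →
        ∃ (J : E) (q : J ⟶ I) (u : Fin m → (J ⟶ P.A.carrier)), StrongEpi q ∧
          (∀ i, (U i).Factors (u i)) ∧
          ∀ (x : J ⟶ P.A.pow (m + 1)) (z : J ⟶ P.A.carrier),
            (∀ i : Fin m, x ≫ P.A.proj i.castSucc = u i) → f.At x z →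
              ∃ w, P.A.App (q ≫ c) (x ≫ P.A.proj (Fin.last m)) w ∧ P.A.Le w z := by
  obtain ⟨V, rV, hV⟩ := P.complete f hf
  have args_eq : ∀ ⦃I : E⦄ (x : I ⟶ P.A.pow (m + 1)), P.A.args x =
      (List.ofFn fun i : Fin m => x ≫ P.A.proj i.castSucc) ++ [x ≫ P.A.proj (Fin.last m)] := by
    intro I x
    rw [OPAS.args, List.ofFn_succ', List.concat_eq_append]
  obtain ⟨W, hW, kW⟩ := P.exists_apps hV (List.ofFn U) (by simpa [List.mem_ofFn] using hU) (by
    intro I a l ha hl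
    rw [List.length_ofFn] at hl
    subst hl
    obtain ⟨x, hx⟩ := P.A.exists_tuple (n := l.length + 1) (Fin.snoc (fun i => l.get i) a)
    obtain ⟨z, hz⟩ := (rV a x ha).1
    refine ⟨z, ?_⟩
    rw [args_eq, List.dropLast_concat] at hz
    simpa [hx] using hz)
  refine ⟨W, hW, fun I c hc => ?_⟩
  obtain ⟨J, q, a, l, hq, ha, hl, hal⟩ := kW c hc
  have hlen := hl.length_eq
  rw [List.length_ofFn] at hlen
  subst hlen
  refine ⟨J, q, l.get, hq, fun i => ?_, fun x z hx hz => ?_⟩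
  · simpa using hl.get (i := i.1) (by simp) i.2
  · obtain ⟨w, hw, hle⟩ := (rV a x ha).2 z hz
    rw [args_eq, OPAS.apps_append] at hw
    simp only [hx, List.ofFn_get] at hw
    obtain ⟨y, hy, w', hw', rfl⟩ := hw
    obtain rfl := hal.unique hy
    exact ⟨_, hw', hle⟩

theorem at_proj {n : ℕ} {I : E} (x : I ⟶ P.A.pow n) (i : Fin n) {y : I ⟶ P.A.carrier}
    (h : x ≫ P.A.proj i = y) : (PartialArrow.ofHom (P.A.proj i)).At x y :=
  (PartialArrow.at_ofHom _ _ _).2 h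

/-- Realizers `a` of evaluation at elements of `U`: locally `a v ≤ v k` for some `k ∈ U`. -/
theorem exists_eval {U : Subobject P.A.carrier} (hU : Intersects U P.sub) :
    ∃ W : Subobject P.A.carrier, Intersects W P.sub ∧
      ∀ ⦃I : E⦄ (c : I ⟶ P.A.carrier), W.Factors c →
        ∃ (J : E) (q : J ⟶ I) (k : J ⟶ P.A.carrier), StrongEpi q ∧ U.Factors k ∧
          ∀ y z : J ⟶ P.A.carrier, P.A.App y k z →
            ∃ w, P.A.App (q ≫ c) y w ∧ P.A.Le w z := by
  obtain ⟨W, hW, kW⟩ := P.exists_realizers (m := 1) _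
    (.app _ _ (OPAS.IsCombinatory.proj (A := P.A) (1 : Fin 2)) (.proj (0 : Fin 2)))
    (fun _ => U) (fun _ => hU)
  refine ⟨W, hW, fun I c hc => ?_⟩
  obtain ⟨J, q, k, hq, hk, h⟩ := kW c hc
  refine ⟨J, q, k 0, hq, hk 0, fun y z hz => ?_⟩
  obtain ⟨x, hx⟩ := P.A.exists_tuple ![k 0, y]
  have hx0 : x ≫ P.A.proj (0 : Fin 2) = k 0 := hx 0
  have hx1 : x ≫ P.A.proj (1 : Fin 2) = y := hx 1
  obtain ⟨w, hw, hle⟩ := h x z (fun i => by obtain rfl := Fin.fin_one_eq_zero i; exact hx0)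
    (OPAS.at_pointwiseApp _ _ _ _ (P.at_proj _ _ hx1) (P.at_proj _ _ hx0) hz)
  refine ⟨w, ?_, hle⟩
  rwa [show x ≫ P.A.proj (Fin.last 1) = y from hx1] at hw

/-- Realizers of constant functions with value in `U`. -/
theorem exists_const {U : Subobject P.A.carrier} (hU : Intersects U P.sub) :
    ∃ W : Subobject P.A.carrier, Intersects W P.sub ∧
      ∀ ⦃I : E⦄ (c b : I ⟶ P.A.carrier), W.Factors c →
        ∃ (J : E) (q : J ⟶ I) (k w : J ⟶ P.A.carrier), StrongEpi q ∧ U.Factors k ∧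
          P.A.App (q ≫ c) (q ≫ b) w ∧ P.A.Le w k := by
  obtain ⟨W, hW, kW⟩ := P.exists_realizers (m := 1) _
    (OPAS.IsCombinatory.proj (A := P.A) (0 : Fin 2)) (fun _ => U) (fun _ => hU)
  refine ⟨W, hW, fun I c b hc => ?_⟩
  obtain ⟨J, q, k, hq, hk, h⟩ := kW c hc
  obtain ⟨x, hx⟩ := P.A.exists_tuple ![k 0, q ≫ b]
  have hx0 : x ≫ P.A.proj (0 : Fin 2) = k 0 := hx 0
  have hx1 : x ≫ P.A.proj (1 : Fin 2) = q ≫ b := hx 1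
  obtain ⟨w, hw, hle⟩ := h x _ (fun i => by obtain rfl := Fin.fin_one_eq_zero i; exact hx0)
    (P.at_proj _ _ hx0)
  refine ⟨J, q, k 0, w, hq, hk 0, ?_, hle⟩
  rwa [show x ≫ P.A.proj (Fin.last 1) = q ≫ b from hx1] at hw

/-- Realizers of pointwise applications: locally `c b ≤ (u b) (v b)` for some `u ∈ U`, `v ∈ V`. -/
theorem exists_pointwise {U V : Subobject P.A.carrier} (hU : Intersects U P.sub)
    (hV : Intersects V P.sub) :
    ∃ W : Subobject P.A.carrier, Intersects W P.sub ∧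
      ∀ ⦃I : E⦄ (c b : I ⟶ P.A.carrier), W.Factors c →
        ∃ (J : E) (q : J ⟶ I) (u v : J ⟶ P.A.carrier), StrongEpi q ∧ U.Factors u ∧
          V.Factors v ∧ ∀ s t r : J ⟶ P.A.carrier, P.A.App u (q ≫ b) s → P.A.App v (q ≫ b) t →
            P.A.App s t r → ∃ w, P.A.App (q ≫ c) (q ≫ b) w ∧ P.A.Le w r := by
  obtain ⟨W, hW, kW⟩ := P.exists_realizers (m := 2) _
    (.app _ _ (.app _ _ (OPAS.IsCombinatory.proj (A := P.A) (0 : Fin 3)) (.proj (2 : Fin 3)))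
      (.app _ _ (.proj (1 : Fin 3)) (.proj (2 : Fin 3))))
    ![U, V] (fun i => by fin_cases i <;> assumption)
  refine ⟨W, hW, fun I c b hc => ?_⟩
  obtain ⟨J, q, k, hq, hk, h⟩ := kW c hc
  refine ⟨J, q, k 0, k 1, hq, hk 0, hk 1, fun s t r hs ht hr => ?_⟩
  obtain ⟨x, hx⟩ := P.A.exists_tuple ![k 0, k 1, q ≫ b]
  have hx0 : x ≫ P.A.proj (0 : Fin 3) = k 0 := hx 0
  have hx1 : x ≫ P.A.proj (1 : Fin 3) = k 1 := hx 1
  have hx2 : x ≫ P.A.proj (2 : Fin 3) = q ≫ b := hx 2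
  obtain ⟨w, hw, hle⟩ := h x r (fun i => by fin_cases i <;> assumption)
    (OPAS.at_pointwiseApp _ _ _ _
      (OPAS.at_pointwiseApp _ _ _ _ (P.at_proj _ _ hx0) (P.at_proj _ _ hx2) hs)
      (OPAS.at_pointwiseApp _ _ _ _ (P.at_proj _ _ hx1) (P.at_proj _ _ hx2) ht) hr)
  refine ⟨w, ?_, hle⟩
  rwa [show x ≫ P.A.proj (Fin.last 2) = q ≫ b from hx2] at hw

/-- Realizers of a projection `A² → A`. -/
theorem exists_proj (i : Fin 2) :
    ∃ W : Subobject P.A.carrier, Intersects W P.sub ∧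
      ∀ ⦃I : E⦄ (a : I ⟶ P.A.carrier) (x : Fin 2 → (I ⟶ P.A.carrier)), W.Factors a →
        ∃ r s, P.A.App a (x 0) r ∧ P.A.App r (x 1) s ∧ P.A.Le s (x i) := by
  obtain ⟨W, rW, hW⟩ := P.complete _ (OPAS.IsCombinatory.proj (A := P.A) i)
  refine ⟨W, hW, fun I a x ha => ?_⟩
  obtain ⟨t, ht⟩ := P.A.exists_tuple x
  obtain ⟨z, hz, hle⟩ := (rW a t ha).2 _ (P.at_proj _ _ (ht i))
  simp only [OPAS.args, ht, List.ofFn_succ, List.ofFn_zero, OPAS.Apps] at hz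
  obtain ⟨r, hr, s, hs, rfl⟩ := hz
  exact ⟨r, s, hr, hs, hle⟩

theorem exists_pairing : ∃ (V : Subobject P.A.carrier) (U : Fin 2 → Subobject P.A.carrier),
    Intersects V P.sub ∧ (∀ i, Intersects (U i) P.sub) ∧
      ∀ ⦃I : E⦄ (p : I ⟶ P.A.carrier) (x : Fin 2 → (I ⟶ P.A.carrier)), V.Factors p →
        ∃ r s, P.A.App p (x 0) r ∧ P.A.App r (x 1) s ∧
          ∀ i a, (U i).Factors a → ∃ w, P.A.App a s w ∧ P.A.Le w (x i) := by
  obtain ⟨V, rV, hV⟩ := P.complete _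
    (.app _ _ (.app _ _ (OPAS.IsCombinatory.proj (A := P.A) (2 : Fin 3)) (.proj (0 : Fin 3)))
      (.proj (1 : Fin 3)))
  choose K hK kK using P.exists_proj
  choose U hU kU using fun i => P.exists_eval (hK i)
  refine ⟨V, U, hV, hU, fun I p x hp => ?_⟩
  obtain ⟨t₀, ht₀⟩ := P.A.exists_tuple ![x 0, x 1, x 1]
  obtain ⟨z, hz⟩ := (rV p t₀ hp).1
  simp only [OPAS.args, ht₀, List.ofFn_succ, List.ofFn_zero, OPAS.Apps, List.dropLast] at hz
  obtain ⟨r, hr, s, hs, rfl⟩ := hz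
  refine ⟨r, s, hr, hs, fun i a ha => ?_⟩
  obtain ⟨J, q, k, _, hk, h⟩ := kU i a ha
  obtain ⟨m, n, hm, hn, hle⟩ := kK i k (fun j => q ≫ x j) hk
  obtain ⟨t, ht⟩ := P.A.exists_tuple ![q ≫ x 0, q ≫ x 1, k]
  have ht0 : t ≫ P.A.proj (0 : Fin 3) = q ≫ x 0 := ht 0
  have ht1 : t ≫ P.A.proj (1 : Fin 3) = q ≫ x 1 := ht 1
  have ht2 : t ≫ P.A.proj (2 : Fin 3) = k := ht 2
  obtain ⟨y, hy, hle'⟩ := (rV (q ≫ p) t (factors_comp hp q)).2 n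
    (OPAS.at_pointwiseApp _ _ _ _
      (OPAS.at_pointwiseApp _ _ _ _ (P.at_proj _ _ ht2) (P.at_proj _ _ ht0) hm)
      (P.at_proj _ _ ht1) hn)
  simp only [OPAS.args, ht, List.ofFn_succ, List.ofFn_zero, OPAS.Apps] at hy
  obtain ⟨r', hr', s', hs', y', hy', rfl⟩ := hy
  obtain rfl : q ≫ r = r' := (hr.comp q).unique hr'
  obtain rfl : q ≫ s = s' := (hs.comp q).unique hs'
  obtain ⟨w, hw, hle''⟩ := h (q ≫ s) y' hy'
  obtain ⟨w', hw', rfl⟩ := OPAS.exists_app_of_cover q hw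
  exact ⟨w', hw', OPAS.le_of_cover q (hle''.trans (hle'.trans hle))⟩

/-- An inhabited object of pairing combinators. -/
noncomputable def pairing : Subobject P.A.carrier := P.exists_pairing.choose

/-- Inhabited objects of realizers of the two projections. -/
noncomputable def unpairing : Fin 2 → Subobject P.A.carrier := P.exists_pairing.choose_spec.choose

theorem intersects_pairing : Intersects P.pairing P.sub :=
  P.exists_pairing.choose_spec.choose_spec.1

theorem intersects_unpairing (i : Fin 2) : Intersects (P.unpairing i) P.sub :=
  P.exists_pairing.choose_spec.choose_spec.2.1 i

theorem exists_pair {I : E} {p : I ⟶ P.A.carrier} (x y : I ⟶ P.A.carrier)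
    (hp : P.pairing.Factors p) :
    ∃ r s, P.A.App p x r ∧ P.A.App r y s ∧
      (∀ a, (P.unpairing 0).Factors a → ∃ w, P.A.App a s w ∧ P.A.Le w x) ∧
      (∀ a, (P.unpairing 1).Factors a → ∃ w, P.A.App a s w ∧ P.A.Le w y) := by
  obtain ⟨r, s, hr, hs, h⟩ := P.exists_pairing.choose_spec.choose_spec.2.2 p ![x, y] hp
  exact ⟨r, s, hr, hs, h 0, h 1⟩

/-- Realizers of `b ↦ ⟨u b, v b⟩`, for `u ∈ U` and `v ∈ V`. -/
theorem exists_pair_realizers {U V : Subobject P.A.carrier} (hU : Intersects U P.sub)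
    (hV : Intersects V P.sub) :
    ∃ W : Subobject P.A.carrier, Intersects W P.sub ∧
      ∀ ⦃I : E⦄ (c b : I ⟶ P.A.carrier), W.Factors c →
        ∃ (J : E) (q : J ⟶ I) (p u v : J ⟶ P.A.carrier), StrongEpi q ∧ P.pairing.Factors p ∧
          U.Factors u ∧ V.Factors v ∧ ∀ s t r r' : J ⟶ P.A.carrier, P.A.App u (q ≫ b) s →
            P.A.App v (q ≫ b) t → P.A.App p s r → P.A.App r t r' →
              ∃ w, P.A.App (q ≫ c) (q ≫ b) w ∧ P.A.Le w r' := by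
  obtain ⟨W, hW, kW⟩ := P.exists_realizers (m := 3) _
    (.app _ _ (.app _ _ (OPAS.IsCombinatory.proj (A := P.A) (0 : Fin 4))
      (.app _ _ (.proj (1 : Fin 4)) (.proj (3 : Fin 4))))
      (.app _ _ (.proj (2 : Fin 4)) (.proj (3 : Fin 4))))
    ![P.pairing, U, V] (fun i => by
      have := P.intersects_pairing
      fin_cases i <;> assumption)
  refine ⟨W, hW, fun I c b hc => ?_⟩
  obtain ⟨J, q, k, hq, hk, h⟩ := kW c hc
  refine ⟨J, q, k 0, k 1, k 2, hq, hk 0, hk 1, hk 2, fun s t r r' hs ht hr hr' => ?_⟩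
  obtain ⟨x, hx⟩ := P.A.exists_tuple ![k 0, k 1, k 2, q ≫ b]
  have hx0 : x ≫ P.A.proj (0 : Fin 4) = k 0 := hx 0
  have hx1 : x ≫ P.A.proj (1 : Fin 4) = k 1 := hx 1
  have hx2 : x ≫ P.A.proj (2 : Fin 4) = k 2 := hx 2
  have hx3 : x ≫ P.A.proj (3 : Fin 4) = q ≫ b := hx 3
  obtain ⟨w, hw, hle⟩ := h x r' (fun i => by fin_cases i <;> assumption)
    (OPAS.at_pointwiseApp _ _ _ _
      (OPAS.at_pointwiseApp _ _ _ _ (P.at_proj _ _ hx0)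
        (OPAS.at_pointwiseApp _ _ _ _ (P.at_proj _ _ hx1) (P.at_proj _ _ hx3) hs) hr)
      (OPAS.at_pointwiseApp _ _ _ _ (P.at_proj _ _ hx2) (P.at_proj _ _ hx3) ht) hr')
  refine ⟨w, ?_, hle⟩
  rwa [show x ≫ P.A.proj (Fin.last 3) = q ≫ b from hx3] at hw

end OPCAPair

variable {E : Type u} [Category.{v} E] [Regular E] {P : OPCAPair E}

theorem OPCAPair.exists_identity (P : OPCAPair E) :
    ∃ W : Subobject P.A.carrier, Intersects W P.sub ∧
      ∀ ⦃I : E⦄ (a b : I ⟶ P.A.carrier), W.Factors a → ∃ w, P.A.App a b w ∧ P.A.Le w b := by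
  obtain ⟨W, rW, hW⟩ := P.complete _ (OPAS.IsCombinatory.proj (A := P.A) (0 : Fin 1))
  refine ⟨W, hW, fun I a b ha => ?_⟩
  obtain ⟨t, ht⟩ := P.A.exists_tuple (n := 1) fun _ => b
  obtain ⟨z, hz, hle⟩ := (rW a t ha).2 b (P.at_proj _ _ (ht 0))
  simp only [OPAS.args, ht, List.ofFn_succ, List.ofFn_zero, OPAS.Apps] at hz
  obtain ⟨c, hc, rfl⟩ := hz
  exact ⟨c, hc, hle⟩

theorem factors_lift_comp {X Y I J : E} {R : Subobject (X ⨯ Y)} {a : I ⟶ X} {x : I ⟶ Y}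
    (h : R.Factors (prod.lift a x)) (q : J ⟶ I) : R.Factors (prod.lift (q ≫ a) (q ≫ x)) := by
  rw [← prod.comp_lift]; exact factors_comp h q

theorem factors_lift_of_cover {X Y I J : E} {R : Subobject (X ⨯ Y)} {a : I ⟶ X} {x : I ⟶ Y}
    (q : J ⟶ I) [StrongEpi q] (h : R.Factors (prod.lift (q ≫ a) (q ≫ x))) :
    R.Factors (prod.lift a x) := by
  rw [← prod.comp_lift] at h; exact factors_of_cover q h

theorem factors_lift_iff {X Y I : E} {R : Subobject (X ⨯ Y)} {a : I ⟶ X} {x : I ⟶ Y} :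
    R.Factors (prod.lift a x) ↔ ∃ r : I ⟶ (R : E), r ≫ R.arrow ≫ prod.fst = a ∧
      r ≫ R.arrow ≫ prod.snd = x := by
  rw [factors_iff_exists]
  constructor
  · rintro ⟨r, hr⟩
    exact ⟨r, by rw [← Category.assoc, hr, prod.lift_fst], by
      rw [← Category.assoc, hr, prod.lift_snd]⟩
  · rintro ⟨r, rfl, rfl⟩
    exact ⟨r, prod.hom_ext (by rw [prod.lift_fst, Category.assoc])
      (by rw [prod.lift_snd, Category.assoc])⟩

theorem factors_lift_self {X Y : E} (R : Subobject (X ⨯ Y)) :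
    R.Factors (prod.lift (R.arrow ≫ prod.fst) (R.arrow ≫ prod.snd)) :=
  factors_lift_iff.2 ⟨𝟙 _, Category.id_comp _, Category.id_comp _⟩

theorem pullback_factors_iff {X Y I : E} {f : X ⟶ Y} {U : Subobject Y} {x : I ⟶ X} :
    ((Subobject.pullback f).obj U).Factors x ↔ U.Factors (x ≫ f) := by
  have h := Subobject.isPullback f U
  rw [factors_iff_exists, factors_iff_exists]
  constructor
  · rintro ⟨r, rfl⟩
    exact ⟨r ≫ Subobject.pullbackπ f U, by rw [Category.assoc, Category.assoc, h.w]⟩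
  · rintro ⟨r, hr⟩
    exact ⟨h.lift r x hr, h.lift_snd _ _ _⟩

/-- The pairs `(a, x)` with `a ≤ s z` and `x = w z` for some `z`. -/
noncomputable def OPAS.downSub (A : OPAS E) {Z X : E} (s : Z ⟶ A.carrier) (w : Z ⟶ X) :
    Subobject (A.carrier ⨯ X) :=
  imageSub (prod.lift (pullback.fst (A.le.arrow ≫ prod.snd) s ≫ A.le.arrow ≫ prod.fst)
    (pullback.snd (A.le.arrow ≫ prod.snd) s ≫ w))

theorem OPAS.downSub_factors_iff {A : OPAS E} {Z X I : E} {s : Z ⟶ A.carrier} {w : Z ⟶ X}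
    {a : I ⟶ A.carrier} {x : I ⟶ X} : (A.downSub s w).Factors (prod.lift a x) ↔
      ∃ (J : E) (q : J ⟶ I) (z : J ⟶ Z), StrongEpi q ∧ z ≫ w = q ≫ x ∧ A.Le (q ≫ a) (z ≫ s) := by
  rw [OPAS.downSub, imageSub_factors_iff]
  constructor
  · rintro ⟨J, q, y, hq, h⟩
    rw [prod.comp_lift, prod.comp_lift] at h
    have h₁ := congrArg (· ≫ prod.fst) h
    have h₂ := congrArg (· ≫ prod.snd) h
    simp only [prod.lift_fst, prod.lift_snd] at h₁ h₂
    refine ⟨J, q, y ≫ pullback.snd _ _, hq, by simpa using h₂, ?_⟩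
    refine factors_lift_iff.2 ⟨y ≫ pullback.fst _ _, ?_, ?_⟩
    · simpa using h₁
    · simp [pullback.condition]
  · rintro ⟨J, q, z, hq, h, hle⟩
    obtain ⟨r, hr, hr'⟩ := factors_lift_iff.1 hle
    refine ⟨J, q, pullback.lift r z hr', hq, ?_⟩
    rw [prod.comp_lift, prod.comp_lift, pullback.lift_fst_assoc, pullback.lift_snd_assoc, hr, h]

namespace Asm

theorem hom_ext {S T : Asm P} {f g : S ⟶ T} (h : f.1 = g.1) : f = g := Subtype.ext h

@[simp] theorem comp_val {S T R : Asm P} (f : S ⟶ T) (g : T ⟶ R) : (f ≫ g).1 = f.1 ≫ g.1 := rfl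

@[simp] theorem id_val (S : Asm P) : (𝟙 S : S ⟶ S).1 = 𝟙 S.X := rfl

theorem exists_realizer (S : Asm P) {I : E} (x : I ⟶ S.X) :
    ∃ (J : E) (q : J ⟶ I) (b : J ⟶ P.A.carrier), StrongEpi q ∧
      S.Y.Factors (prod.lift b (q ≫ x)) := by
  have := S.total
  obtain ⟨J, q, y, hq, h⟩ := exists_cover_lift (S.Y.arrow ≫ prod.snd) x
  exact ⟨J, q, _, hq, factors_lift_iff.2 ⟨y, rfl, h⟩⟩

theorem total_of_cover {X J : E} {Y : Subobject (P.A.carrier ⨯ X)} (q : J ⟶ X) [StrongEpi q]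
    (b : J ⟶ P.A.carrier) (h : Y.Factors (prod.lift b q)) :
    IsRegularEpi (Y.arrow ≫ prod.snd) := by
  obtain ⟨r, -, hr⟩ := factors_lift_iff.1 h
  have := strongEpi_of_lift (Y.arrow ≫ prod.snd) q r hr
  exact isRegularEpi_of_strongEpi _

/-- The assembly on the codomain of a cover `w : Z ⟶ X` in which `a` realizes `x` if `a ≤ s z` for
some `z` above `x`. -/
noncomputable abbrev ofCover (P : OPCAPair E) {Z X : E} (s : Z ⟶ P.A.carrier) (w : Z ⟶ X)
    [StrongEpi w] : Asm P where
  X := X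
  Y := P.A.downSub s w
  total := total_of_cover w s (OPAS.downSub_factors_iff.2
    ⟨Z, 𝟙 Z, 𝟙 Z, inferInstance, rfl, OPAS.Le.refl _⟩)
  down a b x h hle := by
    obtain ⟨J, q, z, hq, hz, hle'⟩ := OPAS.downSub_factors_iff.1 h
    exact OPAS.downSub_factors_iff.2 ⟨J, q, z, hq, hz, (OPAS.Le.comp hle q).trans hle'⟩

/-- The direct image of the realizers of `S` along a cover. -/
noncomputable abbrev push (S : Asm P) {X : E} (e : S.X ⟶ X) [StrongEpi e] : Asm P :=
  have := S.total
  have : StrongEpi ((S.Y.arrow ≫ prod.snd) ≫ e) := strongEpi_comp _ _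
  ofCover P (S.Y.arrow ≫ prod.fst) ((S.Y.arrow ≫ prod.snd) ≫ e)

theorem push_factors_iff {S : Asm P} {X I : E} {e : S.X ⟶ X} [StrongEpi e]
    {b : I ⟶ P.A.carrier} {x : I ⟶ X} : (S.push e).Y.Factors (prod.lift b x) ↔
      ∃ (J : E) (q : J ⟶ I) (y : J ⟶ S.X), StrongEpi q ∧ y ≫ e = q ≫ x ∧
        S.Y.Factors (prod.lift (q ≫ b) y) := by
  refine OPAS.downSub_factors_iff.trans ⟨?_, ?_⟩
  · rintro ⟨J, q, z, hq, hz, hle⟩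
    refine ⟨J, q, z ≫ S.Y.arrow ≫ prod.snd, hq, by simpa using hz, S.down _ _ _ ?_ hle⟩
    exact factors_lift_comp (factors_lift_self S.Y) z
  · rintro ⟨J, q, y, hq, hy, h⟩
    obtain ⟨r, hr, hr'⟩ := factors_lift_iff.1 h
    refine ⟨J, q, r, hq, ?_, ?_⟩
    · rw [← hy, ← hr']; simp
    · rw [hr]; exact OPAS.Le.refl _

/-- The inverse image of the realizers of `T` along an arrow. -/
noncomputable abbrev reindex (T : Asm P) {X : E} (u : X ⟶ T.X) : Asm P :=
  have key {I : E} (b : I ⟶ P.A.carrier) (x : I ⟶ X) :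
      ((Subobject.pullback (prod.map (𝟙 P.A.carrier) u)).obj T.Y).Factors (prod.lift b x) ↔
        T.Y.Factors (prod.lift b (x ≫ u)) := by
    rw [pullback_factors_iff, prod.lift_map, Category.comp_id]
  { X := X
    Y := (Subobject.pullback (prod.map (𝟙 P.A.carrier) u)).obj T.Y
    total := by
      obtain ⟨J, q, b, _, h⟩ := T.exists_realizer u
      exact total_of_cover q b ((key _ _).2 h)
    down := fun a b x h hle => (key _ _).2 (T.down a b _ ((key _ _).1 h) hle) }

theorem reindex_factors_iff {T : Asm P} {X I : E} {u : X ⟶ T.X} {b : I ⟶ P.A.carrier}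
    {x : I ⟶ X} : (T.reindex u).Y.Factors (prod.lift b x) ↔ T.Y.Factors (prod.lift b (x ≫ u)) := by
  change ((Subobject.pullback (prod.map (𝟙 P.A.carrier) u)).obj T.Y).Factors _ ↔ _
  rw [pullback_factors_iff, prod.lift_map, Category.comp_id]

section Meet

variable (S T : Asm P) {X : E} (u : X ⟶ S.X) (v : X ⟶ T.X)

/-- The object of tuples `(p, b, c, x)` of a pairing combinator `p`, an `x` in `X` and realizers
`b` of `u x` and `c` of `v x`. -/
noncomputable abbrev MeetObj : E :=
  pullback (prod.lift (prod.snd ≫ prod.fst ≫ S.Y.arrow ≫ prod.snd)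
    (prod.snd ≫ prod.snd ≫ T.Y.arrow ≫ prod.snd) :
      (P.pairing : E) ⨯ ((S.Y : E) ⨯ (T.Y : E)) ⟶ S.X ⨯ T.X) (prod.lift u v)

noncomputable def meetComb : MeetObj S T u v ⟶ P.A.carrier :=
  pullback.fst _ _ ≫ prod.fst ≫ P.pairing.arrow

noncomputable def meetLeft : MeetObj S T u v ⟶ P.A.carrier :=
  pullback.fst _ _ ≫ prod.snd ≫ prod.fst ≫ S.Y.arrow ≫ prod.fst

noncomputable def meetRight : MeetObj S T u v ⟶ P.A.carrier :=
  pullback.fst _ _ ≫ prod.snd ≫ prod.snd ≫ T.Y.arrow ≫ prod.fst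

noncomputable def meetBase : MeetObj S T u v ⟶ X := pullback.snd _ _

theorem meetComb_factors : P.pairing.Factors (meetComb S T u v) :=
  factors_comp (factors_comp (Subobject.factors_self _) _) _

theorem meetLeft_factors :
    S.Y.Factors (prod.lift (meetLeft S T u v) (meetBase S T u v ≫ u)) := by
  refine factors_lift_iff.2 ⟨pullback.fst _ _ ≫ prod.snd ≫ prod.fst, by simp [meetLeft], ?_⟩
  have := congrArg (· ≫ prod.fst) (pullback.condition
    (f := (prod.lift (prod.snd ≫ prod.fst ≫ S.Y.arrow ≫ prod.snd)
    (prod.snd ≫ prod.snd ≫ T.Y.arrow ≫ prod.snd) :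
      (P.pairing : E) ⨯ ((S.Y : E) ⨯ (T.Y : E)) ⟶ S.X ⨯ T.X)) (g := prod.lift u v))
  simpa [prod.lift_fst, meetBase] using this

theorem meetRight_factors :
    T.Y.Factors (prod.lift (meetRight S T u v) (meetBase S T u v ≫ v)) := by
  refine factors_lift_iff.2 ⟨pullback.fst _ _ ≫ prod.snd ≫ prod.snd, by simp [meetRight], ?_⟩
  have := congrArg (· ≫ prod.snd) (pullback.condition
    (f := (prod.lift (prod.snd ≫ prod.fst ≫ S.Y.arrow ≫ prod.snd)
    (prod.snd ≫ prod.snd ≫ T.Y.arrow ≫ prod.snd) :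
      (P.pairing : E) ⨯ ((S.Y : E) ⨯ (T.Y : E)) ⟶ S.X ⨯ T.X)) (g := prod.lift u v))
  simpa [prod.lift_snd, meetBase] using this

variable {S T u v} in
theorem exists_meetObj {I : E} {p b c : I ⟶ P.A.carrier} {x : I ⟶ X} (hp : P.pairing.Factors p)
    (hb : S.Y.Factors (prod.lift b (x ≫ u))) (hc : T.Y.Factors (prod.lift c (x ≫ v))) :
    ∃ z : I ⟶ MeetObj S T u v, z ≫ meetComb S T u v = p ∧ z ≫ meetLeft S T u v = b ∧
      z ≫ meetRight S T u v = c ∧ z ≫ meetBase S T u v = x := by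
  obtain ⟨k, rfl⟩ := factors_iff_exists.1 hp
  obtain ⟨l, rfl, hl⟩ := factors_lift_iff.1 hb
  obtain ⟨m, rfl, hm⟩ := factors_lift_iff.1 hc
  refine ⟨pullback.lift (prod.lift k (prod.lift l m)) x ?_, ?_, ?_, ?_, ?_⟩
  · apply prod.hom_ext <;> simp [prod.lift_fst, prod.lift_snd, prod.lift_fst_assoc, prod.lift_snd_assoc, hl, hm]
  all_goals simp [meetComb, meetLeft, meetRight, meetBase, prod.lift_fst_assoc,
    prod.lift_snd_assoc, pullback.lift_fst_assoc, pullback.lift_snd]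

theorem strongEpi_meetBase : StrongEpi (meetBase S T u v) := by
  obtain ⟨J, q, b, _, hb⟩ := S.exists_realizer u
  obtain ⟨K, r, c, _, hc⟩ := T.exists_realizer (q ≫ v)
  obtain ⟨L, p, _, hp, -⟩ := P.intersects_pairing.exists_cover
  have := strongEpi_fst (S := K) (T := L)
  obtain ⟨z, -, -, -, hz⟩ := exists_meetObj (S := S) (T := T) (u := u) (v := v)
    (x := (prod.fst : K ⨯ L ⟶ K) ≫ r ≫ q) (b := prod.fst ≫ r ≫ b) (c := prod.fst ≫ c)
    (factors_comp hp prod.snd)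
    (by simpa only [Category.assoc] using factors_lift_comp (factors_lift_comp hb r) prod.fst)
    (by simpa only [Category.assoc] using factors_lift_comp hc prod.fst)
  have : StrongEpi ((prod.fst : K ⨯ L ⟶ K) ≫ r ≫ q) := inferInstance
  exact strongEpi_of_lift _ _ z hz

/-- The realizer `p b c` of a tuple. -/
noncomputable def meetValue : MeetObj S T u v ⟶ P.A.carrier :=
  (P.exists_pair (meetLeft S T u v) (meetRight S T u v)
    (meetComb_factors S T u v)).choose_spec.choose

theorem meetValue_spec : ∃ r, P.A.App (meetComb S T u v) (meetLeft S T u v) r ∧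
    P.A.App r (meetRight S T u v) (meetValue S T u v) := by
  have := (P.exists_pair (meetLeft S T u v) (meetRight S T u v)
    (meetComb_factors S T u v)).choose_spec.choose_spec
  exact ⟨_, this.1, this.2.1⟩

/-- The assembly on `X` in which `x` is realized by pairs of realizers of `u x` and `v x`. -/
noncomputable abbrev meet : Asm P :=
  have := strongEpi_meetBase S T u v
  ofCover P (meetValue S T u v) (meetBase S T u v)

variable {S T u v}

theorem meet_factors {I : E} {p b c r s a : I ⟶ P.A.carrier} {x : I ⟶ X}
    (hp : P.pairing.Factors p) (hb : S.Y.Factors (prod.lift b (x ≫ u)))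
    (hc : T.Y.Factors (prod.lift c (x ≫ v))) (hr : P.A.App p b r) (hs : P.A.App r c s)
    (ha : P.A.Le a s) : (meet S T u v).Y.Factors (prod.lift a x) := by
  obtain ⟨z, rfl, rfl, rfl, hz⟩ := exists_meetObj hp hb hc
  obtain ⟨r', hr', hs'⟩ := meetValue_spec S T u v
  obtain rfl := hr.unique (hr'.comp z)
  obtain rfl := hs.unique (hs'.comp z)
  refine OPAS.downSub_factors_iff.2 ⟨I, 𝟙 I, z, inferInstance, ?_, ?_⟩
  · rw [hz, Category.id_comp]
  · rwa [Category.id_comp]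

theorem exists_of_meet_factors {I : E} {a : I ⟶ P.A.carrier} {x : I ⟶ X}
    (h : (meet S T u v).Y.Factors (prod.lift a x)) :
    ∃ (J : E) (q : J ⟶ I) (p b c r s : J ⟶ P.A.carrier), StrongEpi q ∧ P.pairing.Factors p ∧
      S.Y.Factors (prod.lift b (q ≫ x ≫ u)) ∧ T.Y.Factors (prod.lift c (q ≫ x ≫ v)) ∧
      P.A.App p b r ∧ P.A.App r c s ∧ P.A.Le (q ≫ a) s := by
  obtain ⟨J, q, z, hq, hz, hle⟩ := OPAS.downSub_factors_iff.1 h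
  obtain ⟨r, hr, hs⟩ := meetValue_spec S T u v
  refine ⟨J, q, _, _, _, _, _, hq, factors_comp (meetComb_factors S T u v) z, ?_, ?_,
    hr.comp z, hs.comp z, hle⟩
  · have := factors_lift_comp (meetLeft_factors S T u v) z
    rwa [← Category.assoc, hz, Category.assoc] at this
  · have := factors_lift_comp (meetRight_factors S T u v) z
    rwa [← Category.assoc, hz, Category.assoc] at this

end Meet

end Asm

/-- Tracking may be checked locally. -/
theorem isTracked_of_local (S T : Asm P) (f : S.X ⟶ T.X) {V : Subobject P.A.carrier}
    (hV : Intersects V P.sub)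
    (h : ∀ ⦃I : E⦄ (a b : I ⟶ P.A.carrier) (x : I ⟶ S.X), V.Factors a →
      S.Y.Factors (prod.lift b x) → ∃ (J : E) (q : J ⟶ I) (c : J ⟶ P.A.carrier), StrongEpi q ∧
        P.A.App (q ≫ a) (q ≫ b) c ∧ T.Y.Factors (prod.lift c (q ≫ x ≫ f))) :
    IsTracked S T f := by
  refine ⟨V, hV, fun I a b x ha hb => ?_⟩
  obtain ⟨J, q, c, _, hc, hT⟩ := h a b x ha hb
  obtain ⟨d, hd, rfl⟩ := OPAS.exists_app_of_cover q hc
  exact ⟨d, hd, factors_lift_of_cover q hT⟩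

namespace Asm

section Meet

variable {S T R : Asm P} {X : E} (u : X ⟶ S.X) (v : X ⟶ T.X)

noncomputable def meetFst : meet S T u v ⟶ S :=
  ⟨u, by
    refine isTracked_of_local _ _ _ (P.intersects_unpairing 0) fun I a n x ha hn => ?_
    obtain ⟨J, q, p, b, c, r, s, hq, hp, hb, hc, hr, hs, hle⟩ := exists_of_meet_factors hn
    obtain ⟨r', s', hr', hs', h, -⟩ := P.exists_pair b c hp
    obtain rfl := hr.unique hr'
    obtain rfl := hs.unique hs'
    obtain ⟨w, hw, hwb⟩ := h _ (factors_comp ha q)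
    obtain ⟨w', hw', hle'⟩ := hw.mono (OPAS.Le.refl _) hle
    exact ⟨J, q, w', hq, hw', S.down _ _ _ hb (hle'.trans hwb)⟩⟩

noncomputable def meetSnd : meet S T u v ⟶ T :=
  ⟨v, by
    refine isTracked_of_local _ _ _ (P.intersects_unpairing 1) fun I a n x ha hn => ?_
    obtain ⟨J, q, p, b, c, r, s, hq, hp, hb, hc, hr, hs, hle⟩ := exists_of_meet_factors hn
    obtain ⟨r', s', hr', hs', -, h⟩ := P.exists_pair b c hp
    obtain rfl := hr.unique hr'
    obtain rfl := hs.unique hs'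
    obtain ⟨w, hw, hwb⟩ := h _ (factors_comp ha q)
    obtain ⟨w', hw', hle'⟩ := hw.mono (OPAS.Le.refl _) hle
    exact ⟨J, q, w', hq, hw', T.down _ _ _ hc (hle'.trans hwb)⟩⟩

theorem isTracked_meet (h : R.X ⟶ X) (hu : IsTracked R S (h ≫ u)) (hv : IsTracked R T (h ≫ v)) :
    IsTracked R (meet S T u v) h := by
  obtain ⟨U, hU, tU⟩ := hu
  obtain ⟨V, hV, tV⟩ := hv
  obtain ⟨W, hW, kW⟩ := P.exists_pair_realizers hU hV
  refine isTracked_of_local _ _ _ hW fun I a b x ha hb => ?_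
  obtain ⟨J, q, p, f, g, hq, hp, hf, hg, k⟩ := kW a b ha
  obtain ⟨s, hs, hs'⟩ := tU f (q ≫ b) (q ≫ x) hf (factors_lift_comp hb q)
  obtain ⟨t, ht, ht'⟩ := tV g (q ≫ b) (q ≫ x) hg (factors_lift_comp hb q)
  obtain ⟨r, r', hr, hr', -, -⟩ := P.exists_pair s t hp
  obtain ⟨w, hw, hle⟩ := k s t r r' hs ht hr hr'
  exact ⟨J, q, w, hq, hw, meet_factors hp (by simpa using hs') (by simpa using ht') hr hr' hle⟩

variable {u v} in
theorem isPullback_meet {f : S ⟶ R} {g : T ⟶ R} (h : IsPullback u v f.1 g.1) :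
    IsPullback (meetFst u v) (meetSnd u v) f g :=
  ⟨⟨hom_ext h.w⟩, ⟨PullbackCone.IsLimit.mk _
    (fun s => ⟨h.lift s.fst.1 s.snd.1 (congrArg Subtype.val s.condition),
      isTracked_meet u v _ (by rw [h.lift_fst]; exact s.fst.2) (by rw [h.lift_snd]; exact s.snd.2)⟩)
    (fun s => hom_ext (h.lift_fst _ _ _)) (fun s => hom_ext (h.lift_snd _ _ _))
    (fun s _ h₁ h₂ => hom_ext (h.hom_ext
      ((congrArg Subtype.val h₁).trans (h.lift_fst _ _ _).symm)
      ((congrArg Subtype.val h₂).trans (h.lift_snd _ _ _).symm)))⟩⟩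

end Meet

theorem isTracked_top {S : Asm P} {X : E} (f : S.X ⟶ X) : IsTracked S ((nabla P).obj X) f :=
  isTracked_of_le _ _ _ fun _ _ _ _ => Subobject.top_factors _

/-- The object `∇ 1` is terminal. -/
noncomputable def isTerminalNabla : IsTerminal ((nabla P).obj (⊤_ E)) :=
  IsTerminal.ofUniqueHom (fun S => ⟨terminal.from S.X, isTracked_top _⟩)
    (fun S _ => hom_ext (Subsingleton.elim (α := S.X ⟶ ⊤_ E) _ _))

instance : HasFiniteLimits (Asm P) := by
  have : HasTerminal (Asm P) := isTerminalNabla.hasTerminal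
  have : HasPullbacks (Asm P) := by
    refine @hasPullbacks_of_hasLimit_cospan _ _ fun {S T R f g} => ?_
    exact (isPullback_meet (IsPullback.of_hasPullback f.1 g.1)).hasPullback
  exact hasFiniteLimits_of_hasTerminal_and_pullbacks

/-- The forgetful functor from assemblies. -/
@[simps]
def forget (P : OPCAPair E) : Asm P ⥤ E where
  obj S := S.X
  map f := f.1

/-- The forgetful functor is left adjoint to `∇`. -/
noncomputable def forgetAdj (P : OPCAPair E) : forget P ⊣ nabla P :=
  Adjunction.mkOfHomEquiv
    { homEquiv := fun S X =>
        { toFun := fun f => ⟨f, isTracked_top f⟩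
          invFun := fun f => f.1
          left_inv := fun _ => rfl
          right_inv := fun _ => rfl } }

/-- The morphism from an assembly to the image of its realizers along a cover. -/
noncomputable def toPush (S : Asm P) {X : E} (e : S.X ⟶ X) [StrongEpi e] : S ⟶ S.push e :=
  ⟨e, isTracked_of_le _ _ _ fun I b x hb => push_factors_iff.2
    ⟨I, 𝟙 I, x, inferInstance, by simp, by simpa using hb⟩⟩

theorem isTracked_push {S T : Asm P} {X : E} {e : S.X ⟶ X} [StrongEpi e] {f : X ⟶ T.X}
    (h : IsTracked S T (e ≫ f)) : IsTracked (S.push e) T f := by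
  obtain ⟨V, hV, tV⟩ := h
  refine isTracked_of_local _ _ _ hV fun I a b x ha hb => ?_
  obtain ⟨J, q, y, hq, hy, hS⟩ := push_factors_iff.1 hb
  obtain ⟨c, hc, hT⟩ := tV (q ≫ a) (q ≫ b) y (factors_comp ha q) hS
  refine ⟨J, q, c, hq, hc, ?_⟩
  rwa [← Category.assoc, hy, Category.assoc] at hT

/-- A *cover* of assemblies: a cover of the underlying objects such that, uniformly, realizers of
an element of the codomain yield realizers of some element above it. -/
def IsCover {S T : Asm P} (f : S ⟶ T) : Prop :=
  ∃ _ : StrongEpi f.1, IsTracked T (S.push f.1) (𝟙 T.X)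

theorem isRegularEpi_of_isCover {S T : Asm P} {f : S ⟶ T} (hf : IsCover f) :
    IsRegularEpi f := by
  obtain ⟨_, hT⟩ := hf
  have : IsRegularEpi f.1 := isRegularEpi_of_strongEpi _
  have hepi : Epi f := ⟨fun g h e => hom_ext ((cancel_epi f.1).1 (congrArg Subtype.val e))⟩
  refine IsRegularEpi.of_epi_of_exists fun Z g hg => ?_
  have hm : meetFst (pullback.fst f.1 f.1) (pullback.snd f.1 f.1) ≫ g =
      meetSnd (pullback.fst f.1 f.1) (pullback.snd f.1 f.1) ≫ g := by
    have w := (isPullback_meet (f := f) (g := f) (IsPullback.of_hasPullback f.1 f.1)).w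
    rw [← pullback.lift_fst _ _ w, Category.assoc, hg, pullback.lift_snd_assoc]
  obtain ⟨h, hh⟩ := IsRegularEpi.exists_of_isKernelPair f.1 (IsKernelPair.of_hasPullback f.1)
    g.1 (congrArg Subtype.val hm)
  refine ⟨⟨h, ?_⟩, hom_ext hh⟩
  have := isTracked_comp _ _ _ _ _ hT (isTracked_push (e := f.1) (T := Z) (f := h)
    (by rw [hh]; exact g.2))
  rwa [Category.id_comp] at this

theorem isCover_of_strongEpi {S T : Asm P} (f : S ⟶ T) [StrongEpi f] : IsCover f := by
  let m : S.push (factorThruImage f.1) ⟶ T :=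
    ⟨image.ι f.1, isTracked_push (by rw [image.fac]; exact f.2)⟩
  have hm : S.toPush (factorThruImage f.1) ≫ m = f := hom_ext (image.fac f.1)
  have : Mono m := ⟨fun g h e => hom_ext ((cancel_mono (image.ι f.1)).1 (congrArg Subtype.val e))⟩
  have : StrongEpi (S.toPush (factorThruImage f.1) ≫ m) := by rwa [hm]
  have : StrongEpi m := strongEpi_of_strongEpi (S.toPush (factorThruImage f.1)) m
  have : IsIso m := isIso_of_mono_of_strongEpi m
  have : IsIso (image.ι f.1) := inferInstanceAs (IsIso ((forget P).map m))
  have hf : StrongEpi f.1 := by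
    rw [← image.fac f.1]
    exact strongEpi_comp _ _
  refine ⟨hf, ?_⟩
  have h₁ : IsTracked (S.push (factorThruImage f.1)) (S.push f.1) (image.ι f.1) :=
    isTracked_push (by rw [image.fac]; exact (S.toPush f.1).2)
  have h₂ := isTracked_comp _ _ _ _ _ (inv m).2 h₁
  have h₃ : (inv m).1 ≫ image.ι f.1 = 𝟙 T.X := congrArg Subtype.val (IsIso.inv_hom_id m)
  rwa [h₃] at h₂

theorem isCover_meetSnd {S T R : Asm P} {f : S ⟶ T} (hf : IsCover f) (g : R ⟶ T) {X : E}
    {u : X ⟶ S.X} {v : X ⟶ R.X} (h : IsPullback u v f.1 g.1) : IsCover (meetSnd u v) := by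
  obtain ⟨_, hT⟩ := hf
  have hv : StrongEpi v := by
    have : IsRegularEpi v :=
      Regular.regularEpiIsStableUnderBaseChange.of_isPullback h (isRegularEpi_of_strongEpi f.1)
    infer_instance
  suffices key : IsTracked R ((meet S R u v).push v) (𝟙 R.X) from ⟨hv, key⟩
  have hg := isTracked_comp _ _ _ _ _ g.2 hT
  rw [Category.comp_id] at hg
  obtain ⟨V, hV, tV⟩ := hg
  obtain ⟨U, hU, kU⟩ := P.exists_identity
  obtain ⟨W, hW, kW⟩ := P.exists_pair_realizers hV hU
  refine isTracked_of_local _ _ _ hW fun I a b x ha hb => ?_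
  obtain ⟨J, q, p, k, i, hq, hp, hk, hi, hw⟩ := kW a b ha
  obtain ⟨s, hs, hs'⟩ := tV k (q ≫ b) (q ≫ x) hk (factors_lift_comp hb q)
  obtain ⟨t, ht, hle⟩ := kU i (q ≫ b) hi
  obtain ⟨r, r', hr, hr', -, -⟩ := P.exists_pair s t hp
  obtain ⟨w, hw, hle'⟩ := hw s t r r' hs ht hr hr'
  refine ⟨J, q, w, hq, hw, push_factors_iff.2 ?_⟩
  obtain ⟨K, q', y, hq', hy, hS⟩ := push_factors_iff.1 hs'
  refine ⟨K, q', h.lift y (q' ≫ q ≫ x) (by simpa using hy), hq', ?_, ?_⟩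
  · refine (h.lift_snd _ _ _).trans ?_
    rw [Category.comp_id]
  · refine meet_factors (factors_comp hp q') ?_ ?_ (hr.comp q') (hr'.comp q') (hle'.comp q')
    · rwa [h.lift_fst]
    · rw [h.lift_snd]
      exact factors_lift_comp (R.down _ _ _ (factors_lift_comp hb q) hle) q'

instance : Regular (Asm P) where
  hasCoequalizer_of_isKernelPair {S T R f g₁ g₂} k := by
    let m : S.push (factorThruImage f.1) ⟶ T :=
      ⟨image.ι f.1, isTracked_push (by rw [image.fac]; exact f.2)⟩
    have hm : S.toPush (factorThruImage f.1) ≫ m = f := hom_ext (image.fac f.1)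
    have : Mono m :=
      ⟨fun g h e => hom_ext ((cancel_mono (image.ι f.1)).1 (congrArg Subtype.val e))⟩
    rw [← hm] at k
    have : IsRegularEpi (S.toPush (factorThruImage f.1)) :=
      isRegularEpi_of_isCover ⟨inferInstanceAs (StrongEpi (factorThruImage f.1)),
        (𝟙 (S.push (factorThruImage f.1)) : _ ⟶ _).2⟩
    exact ⟨⟨⟨_, k.cancel_right_of_mono.toCoequalizer'⟩⟩⟩
  regularEpiIsStableUnderBaseChange :=
    { of_isPullback := fun {R S Q T g f f' g'} sq hf => by
        have : IsRegularEpi f := hf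
        have h := IsPullback.of_hasPullback f.1 g.1
        have hc : IsRegularEpi (meetSnd (pullback.fst f.1 g.1) (pullback.snd f.1 g.1)) :=
          isRegularEpi_of_isCover (isCover_meetSnd (isCover_of_strongEpi f) g h)
        let k : meet S R (pullback.fst f.1 g.1) (pullback.snd f.1 g.1) ⟶ Q :=
          sq.lift (meetFst _ _) (meetSnd _ _) (isPullback_meet h).w
        have hk : k ≫ g' = meetSnd _ _ := sq.lift_snd _ _ _
        have : StrongEpi (k ≫ g') := by
          rw [hk]
          infer_instance
        have : StrongEpi g' := strongEpi_of_strongEpi k g'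
        exact isRegularEpi_of_isCover (isCover_of_strongEpi g') }

end Asm

open Asm

instance nabla_regularFunctor (P : OPCAPair E) : RegularFunctor (nabla P) where
  toPreservesFiniteLimits :=
    have : PreservesLimitsOfSize.{0, 0} (nabla P) := (forgetAdj P).rightAdjoint_preservesLimits
    PreservesLimitsOfSize.preservesFiniteLimits _
  map_regularEpi {X Y} f _ := by
    have hf : StrongEpi ((nabla P).map f).1 := inferInstanceAs (StrongEpi f)
    refine isRegularEpi_of_isCover ⟨hf, isTracked_of_le _ _ _ fun I b x _ => ?_⟩
    obtain ⟨J, q, y, hq, hy⟩ := exists_cover_lift f x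
    exact push_factors_iff.2 ⟨J, q, y, hq, hy.trans
      (congrArg (q ≫ ·) (Category.comp_id x).symm), Subobject.top_factors _⟩

theorem ring_factors_iff {S : Asm P} {x : S ⟶ (nabla P).obj P.A.carrier} :
    (ring P).Factors x ↔ IsTracked S (ringAsm P) x.1 := by
  rw [ring, mk_factors_iff']
  constructor
  · rintro ⟨y, rfl⟩
    have := y.2
    rwa [show (y ≫ ringι P).1 = y.1 from Category.comp_id y.1]
  · intro h
    exact ⟨⟨x.1, h⟩, hom_ext (Category.comp_id x.1)⟩

theorem OPAS.app_of_lift {A : OPAS E} {I : E} {x y z : I ⟶ A.carrier} {r : I ⟶ (A.app.dom : E)}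
    (hx : r ≫ A.app.dom.arrow ≫ prod.fst = x) (hy : r ≫ A.app.dom.arrow ≫ prod.snd = y)
    (hz : r ≫ A.app.hom = z) : A.App x y z := by
  refine ⟨r, prod.hom_ext ?_ ?_, hz⟩
  · rw [prod.lift_fst, Category.assoc, hx]
  · rw [prod.lift_snd, Category.assoc, hy]

theorem ring_isFilter (P : OPCAPair E) : IsFilter P (nabla P) (ring P) where
  up {S} x y hx := by
    rintro ⟨r, rfl, rfl⟩
    rw [ring_factors_iff] at hx ⊢
    obtain ⟨V, hV, tV⟩ := hx
    refine ⟨V, hV, fun I a b x ha hb => ?_⟩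
    obtain ⟨c, hc, hle⟩ := tV a b x ha hb
    refine ⟨c, hc, P.A.le_trans _ _ _ hle ?_⟩
    have := factors_lift_comp (factors_lift_self P.A.le) (x ≫ r.1)
    exact (Category.assoc x r.1 (P.A.le.arrow ≫ prod.fst)) ▸
      (Category.assoc x r.1 (P.A.le.arrow ≫ prod.snd)) ▸ this
  app {S} x y z hx hy := by
    rintro ⟨r, rfl, rfl, rfl⟩
    rw [ring_factors_iff] at hx hy ⊢
    obtain ⟨U, hU, tU⟩ := hx
    obtain ⟨V, hV, tV⟩ := hy
    obtain ⟨W, hW, kW⟩ := P.exists_pointwise hU hV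
    refine isTracked_of_local _ _ _ hW fun I a b i ha hb => ?_
    obtain ⟨J, q, f, g, hq, hf, hg, h⟩ := kW a b ha
    obtain ⟨s, hs, hs'⟩ := tU f (q ≫ b) (q ≫ i) hf (factors_lift_comp hb q)
    obtain ⟨t, ht, ht'⟩ := tV g (q ≫ b) (q ≫ i) hg (factors_lift_comp hb q)
    obtain ⟨w, hw, hle⟩ := (OPAS.app_of_lift (A := P.A) (r := (q ≫ i) ≫ r.1)
      (Category.assoc _ _ _) (Category.assoc _ _ _) (Category.assoc _ _ _)).mono hs' ht'
    obtain ⟨w', hw', hle'⟩ := h s t w hs ht hw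
    refine ⟨J, q, w', hq, hw', ?_⟩
    have := hle'.trans hle
    rwa [Category.assoc] at this
  inter U hU := by
    let T : Asm P := (ringAsm P).reindex U.arrow
    let r : T ⟶ (nabla P).obj P.A.carrier := ⟨U.arrow, isTracked_top _⟩
    let t : T ⟶ (nabla P).obj (⊤_ E) := ⟨terminal.from _, isTracked_top _⟩
    have hs : StrongEpi (terminal.from (U : E)) := by
      obtain ⟨J, j, _, hj, -⟩ := hU.exists_cover
      exact strongEpi_of_lift _ (terminal.from J) (U.factorThru j hj) (Subsingleton.elim _ _)
    have ht : IsRegularEpi t := by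
      refine isRegularEpi_of_isCover ⟨hs, ?_⟩
      obtain ⟨W, hW, kW⟩ := P.exists_const hU
      refine isTracked_of_local _ _ _ hW fun I a b i ha _ => ?_
      obtain ⟨J, q, k, w, hq, hk, hw, hle⟩ := kW a b ha
      refine ⟨J, q, w, hq, hw, (push_factors_iff (S := T) (e := terminal.from (U : E))).2
        ⟨J, 𝟙 J, U.factorThru k hk, inferInstance, Subsingleton.elim (α := J ⟶ ⊤_ E) _ _, ?_⟩⟩
      refine reindex_factors_iff.2 ?_
      have h : P.A.le.Factors (prod.lift (𝟙 J ≫ w) (U.factorThru k hk ≫ U.arrow)) := by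
        rwa [Category.id_comp, Subobject.factorThru_arrow]
      exact h
    have : StrongEpi (terminal.from T) := by
      have h : t ≫ (isTerminalNabla.uniqueUpToIso terminalIsTerminal).hom = terminal.from T :=
        Subsingleton.elim _ _
      rw [← h]
      exact strongEpi_comp _ _
    refine intersects_of_cover r ((mk_factors_iff' _ _).2 ⟨⟨𝟙 _, isTracked_top _⟩, ?_⟩) ?_
    · exact hom_ext (Category.id_comp _)
    · refine ring_factors_iff.2 (isTracked_of_le _ _ _ fun I b x h => ?_)
      exact reindex_factors_iff.1 h

section Transfer

variable {C : Type u₁} [Category.{v₁} C] (F : E ⥤ C)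

theorem exists_map_prod [PreservesFiniteLimits F] [HasFiniteLimits C] {X Y : E} {K : C} (r : K ⟶ F.obj X) (s : K ⟶ F.obj Y) :
    ∃ k : K ⟶ F.obj (X ⨯ Y), k ≫ F.map prod.fst = r ∧ k ≫ F.map prod.snd = s :=
  ⟨prod.lift r s ≫ inv (prodComparison F X Y),
    by rw [Category.assoc, inv_prodComparison_map_fst, prod.lift_fst],
    by rw [Category.assoc, inv_prodComparison_map_snd, prod.lift_snd]⟩

theorem exists_map_pullback [PreservesFiniteLimits F] {X Y Z : E} {K : C} (f : X ⟶ Z) (g : Y ⟶ Z) (r : K ⟶ F.obj X)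
    (s : K ⟶ F.obj Y) (h : r ≫ F.map f = s ≫ F.map g) :
    ∃ k : K ⟶ F.obj (pullback f g), k ≫ F.map (pullback.fst f g) = r ∧
      k ≫ F.map (pullback.snd f g) = s :=
  have w := (IsPullback.of_hasPullback f g).map F
  ⟨w.lift r s h, w.lift_fst _ _ _, w.lift_snd _ _ _⟩

theorem RegularFunctor.map_strongEpi [RegularFunctor F] {X Y : E} (f : X ⟶ Y) [StrongEpi f] :
    StrongEpi (F.map f) := by
  have : IsRegularEpi (F.map f) := RegularFunctor.map_regularEpi f (isRegularEpi_of_strongEpi f)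
  infer_instance

theorem mk_map_ring_arrow {H : Asm P ⥤ C} [RegularFunctor H] {X : C}
    (m : H.obj ((nabla P).obj P.A.carrier) ⟶ X) [Mono m] :
    Subobject.mk (H.map (ring P).arrow ≫ m) = Subobject.mk (H.map (ringι P) ≫ m) := by
  have e : (Subobject.underlyingIso (ringι P)).hom ≫ ringι P = (ring P).arrow :=
    Subobject.underlyingIso_hom_comp_eq_mk _
  have e' : H.map (Subobject.underlyingIso (ringι P)).hom ≫ H.map (ringι P) =
      H.map (ring P).arrow := (H.map_comp _ _).symm.trans (congrArg H.map e)
  exact Subobject.mk_eq_mk_of_comm _ _ (H.mapIso (Subobject.underlyingIso (ringι P)))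
    ((Category.assoc _ _ _).symm.trans (congrArg (· ≫ m) e'))

end Transfer

section Realization

variable {C : Type u₁} [Category.{v₁} C] [Regular C] {F : E ⥤ C}
  {D : Subobject (F.obj P.A.carrier)}

/-- The elements of `F X` which have a realizer in the filter. -/
noncomputable def realized (F : E ⥤ C) (D : Subobject (F.obj P.A.carrier)) (S : Asm P) :
    Subobject (F.obj S.X) :=
  imageSub (pullback.fst (F.map (S.Y.arrow ≫ prod.fst)) D.arrow ≫ F.map (S.Y.arrow ≫ prod.snd))

theorem realized_factors_iff {S : Asm P} {K : C} {x : K ⟶ F.obj S.X} :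
    (realized F D S).Factors x ↔ ∃ (J : C) (q : J ⟶ K) (r : J ⟶ F.obj (S.Y : E)), StrongEpi q ∧
      D.Factors (r ≫ F.map (S.Y.arrow ≫ prod.fst)) ∧
        r ≫ F.map (S.Y.arrow ≫ prod.snd) = q ≫ x := by
  rw [realized, imageSub_factors_iff]
  constructor
  · rintro ⟨J, q, y, hq, h⟩
    refine ⟨J, q, y ≫ pullback.fst _ _, hq, ?_, by rw [← h, Category.assoc]⟩
    exact factors_iff_exists.2 ⟨y ≫ pullback.snd _ _, by
      rw [Category.assoc, Category.assoc, pullback.condition]⟩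
  · rintro ⟨J, q, r, hq, hr, h⟩
    obtain ⟨d, hd⟩ := factors_iff_exists.1 hr
    exact ⟨J, q, pullback.lift r d hd.symm, hq, by rw [pullback.lift_fst_assoc, h]⟩

theorem realized_of_map {S : Asm P} {I : E} {K : C} (k : K ⟶ F.obj I) {b : I ⟶ P.A.carrier}
    {x : I ⟶ S.X} (h : S.Y.Factors (prod.lift b x)) (hb : D.Factors (k ≫ F.map b)) :
    (realized F D S).Factors (k ≫ F.map x) := by
  obtain ⟨r, rfl, rfl⟩ := factors_lift_iff.1 h
  refine realized_factors_iff.2 ⟨K, 𝟙 K, k ≫ F.map r, inferInstance, ?_, ?_⟩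
  · rwa [Category.assoc, ← F.map_comp]
  · rw [Category.assoc, ← F.map_comp, Category.id_comp]

variable [RegularFunctor F]

namespace IsFilter

theorem app_map (hD : IsFilter P F D) {I : E} {K : C} (k : K ⟶ F.obj I) {a b c : I ⟶ P.A.carrier} (h : P.A.App a b c)
    (ha : D.Factors (k ≫ F.map a)) (hb : D.Factors (k ≫ F.map b)) :
    D.Factors (k ≫ F.map c) := by
  obtain ⟨r, hr, rfl⟩ := h
  refine hD.app _ _ _ ha hb ⟨k ≫ F.map r, ?_, ?_, ?_⟩
  · rw [Category.assoc, ← F.map_comp, ← Category.assoc r, hr, prod.lift_fst]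
  · rw [Category.assoc, ← F.map_comp, ← Category.assoc r, hr, prod.lift_snd]
  · rw [Category.assoc, ← F.map_comp]

theorem exists_local (hD : IsFilter P F D) {U : Subobject P.A.carrier} (hU : Intersects U P.sub) (K : C) :
    ∃ (J : C) (q : J ⟶ K) (r : J ⟶ F.obj (U : E)), StrongEpi q ∧
      D.Factors (r ≫ F.map U.arrow) := by
  obtain ⟨L, l, _, hl, hl'⟩ := (hD.inter U hU).exists_cover
  obtain ⟨r, rfl⟩ := (mk_factors_iff' _ _).1 hl
  refine ⟨K ⨯ L, prod.fst, prod.snd ≫ r, strongEpi_fst, ?_⟩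
  rw [Category.assoc]
  exact factors_comp hl' _

end IsFilter

theorem realized_map (hD : IsFilter P F D) {S T : Asm P} {f : S.X ⟶ T.X} (hf : IsTracked S T f)
    {K : C} {x : K ⟶ F.obj S.X} (hx : (realized F D S).Factors x) :
    (realized F D T).Factors (x ≫ F.map f) := by
  obtain ⟨V, hV, tV⟩ := hf
  obtain ⟨J, q, r, _, hr, h⟩ := realized_factors_iff.1 hx
  obtain ⟨L, p, d, _, hd⟩ := hD.exists_local hV J
  obtain ⟨k, rfl, hk⟩ := exists_map_prod F d (p ≫ r)
  obtain ⟨c, hc, hT⟩ := tV (prod.fst ≫ V.arrow) (prod.snd ≫ S.Y.arrow ≫ prod.fst)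
    ((prod.snd : (V : E) ⨯ (S.Y : E) ⟶ _) ≫ S.Y.arrow ≫ prod.snd)
    (factors_comp (Subobject.factors_self _) _) (factors_lift_comp (factors_lift_self _) _)
  refine factors_of_cover q (factors_of_cover p ?_)
  have hx' : p ≫ q ≫ x ≫ F.map f = k ≫ F.map ((prod.snd ≫ S.Y.arrow ≫ prod.snd) ≫ f) := by
    rw [F.map_comp, F.map_comp prod.snd, ← Category.assoc, ← Category.assoc, ← Category.assoc,
      ← Category.assoc, hk, Category.assoc p r, h, Category.assoc, Category.assoc, Category.assoc]
    simp only [Category.assoc]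
  rw [hx']
  refine realized_of_map k hT (hD.app_map k hc ?_ ?_)
  · rwa [F.map_comp, ← Category.assoc]
  · rw [F.map_comp, ← Category.assoc, hk, Category.assoc]
    exact factors_comp hr p

theorem realized_nabla (hD : IsFilter P F D) (X : E) :
    realized F D ((nabla P).obj X) = ⊤ := by
  refine subobject_ext fun K x => ⟨fun _ => Subobject.top_factors _, fun _ => ?_⟩
  obtain ⟨U, hU, -⟩ := P.exists_identity
  obtain ⟨J, q, r, _, hr⟩ := hD.exists_local hU K
  obtain ⟨k, rfl, hk⟩ := exists_map_prod F r (q ≫ x)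
  refine factors_of_cover q ?_
  rw [← hk]
  refine realized_of_map (S := (nabla P).obj X) k (b := prod.fst ≫ U.arrow)
    (Subobject.top_factors _) ?_
  rwa [F.map_comp, ← Category.assoc]

theorem realized_ringAsm (hD : IsFilter P F D) : realized F D (ringAsm P) = D := by
  refine subobject_ext fun K x => ⟨fun h => ?_, fun h => ?_⟩
  · obtain ⟨J, q, r, _, hr, h⟩ := realized_factors_iff.1 h
    exact factors_of_cover q (hD.up _ _ hr ⟨r, rfl, h⟩)
  · have e : x ≫ F.map (𝟙 P.A.carrier) = x :=
      (congrArg (x ≫ ·) (F.map_id P.A.carrier)).trans (Category.comp_id x)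
    have := realized_of_map (S := ringAsm P) (D := D) x (P.A.le_refl (𝟙 _)) (by rwa [e])
    exact e ▸ this

theorem realized_meet (hD : IsFilter P F D) {S T : Asm P} {X : E} {u : X ⟶ S.X} {v : X ⟶ T.X}
    {K : C} {x : K ⟶ F.obj X} (hS : (realized F D S).Factors (x ≫ F.map u))
    (hT : (realized F D T).Factors (x ≫ F.map v)) :
    (realized F D (S.meet T u v)).Factors x := by
  obtain ⟨K₁, q₁, r, _, hr, h₁⟩ := realized_factors_iff.1 hS
  obtain ⟨K₂, q₂, s, _, hs, h₂⟩ := realized_factors_iff.1 (factors_comp hT q₁)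
  obtain ⟨K₃, q₃, d, _, hd⟩ := hD.exists_local P.intersects_pairing K₂
  refine factors_of_cover q₁ (factors_of_cover q₂ (factors_of_cover q₃ ?_))
  have hr' := factors_comp hr (q₃ ≫ q₂)
  have hs' := factors_comp hs q₃
  have h₁' := congrArg ((q₃ ≫ q₂) ≫ ·) h₁
  have h₂' := congrArg (q₃ ≫ ·) h₂
  simp only [← Category.assoc] at h₁' h₂' hr' hs' ⊢
  generalize ((q₃ ≫ q₂) ≫ q₁) ≫ x = y at *
  generalize (q₃ ≫ q₂) ≫ r = r' at *
  generalize q₃ ≫ s = s' at *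
  obtain ⟨k₁, rfl, rfl⟩ := exists_map_pullback F _ _ _ _ h₁'
  rw [Category.assoc, ← F.map_comp] at h₂'
  obtain ⟨k₂, rfl, rfl⟩ := exists_map_pullback F _ _ _ _ h₂'.symm
  obtain ⟨k, rfl, rfl⟩ := exists_map_prod F d k₂
  simp only [Category.assoc, ← F.map_comp] at hd hr' hs' ⊢
  let B := pullback (pullback.snd (S.Y.arrow ≫ prod.snd) u ≫ v) (T.Y.arrow ≫ prod.snd)
  let π : (P.pairing : E) ⨯ B ⟶ B := prod.snd
  have hp := factors_comp (Subobject.factors_self P.pairing) (prod.fst : (P.pairing : E) ⨯ B ⟶ _)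
  have hb := factors_lift_comp (factors_lift_self S.Y)
    (π ≫ pullback.fst _ _ ≫ pullback.fst _ _)
  have hc := factors_lift_comp (factors_lift_self T.Y) (π ≫ pullback.snd _ _)
  simp only [Category.assoc, π] at hb hc
  rw [pullback.condition] at hb
  rw [← pullback.condition] at hc
  obtain ⟨m, n, hm, hn, -⟩ := P.exists_pair _ _ hp
  refine realized_of_map k (Asm.meet_factors hp (by simpa only [Category.assoc] using hb)
    (by simpa only [Category.assoc] using hc) hm hn (OPAS.Le.refl _)) ?_
  exact hD.app_map k hn (hD.app_map k hm hd hr') hs'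

/-- The functor `F_D : Asm(A', A) ⥤ C` induced by an `F`-filter `D`. -/
noncomputable def realization (hD : IsFilter P F D) : Asm P ⥤ C where
  obj S := (realized F D S : C)
  map {S T} f := (realized F D T).factorThru ((realized F D S).arrow ≫ F.map f.1)
    (realized_map hD f.2 (Subobject.factors_self _))
  map_id S := (cancel_mono (realized F D S).arrow).1 ((Subobject.factorThru_arrow _ _ _).trans (by
    rw [Asm.id_val, F.map_id, Category.id_comp, Category.comp_id]))
  map_comp {S T R} f g := by
    rw [← cancel_mono (realized F D R).arrow, Category.assoc]
    simp only [Subobject.factorThru_arrow, Subobject.factorThru_arrow_assoc, Asm.comp_val,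
      F.map_comp, Category.assoc]

/-- The inclusion `F_D (X, Y) ⟶ F X`. -/
noncomputable def realizationι (hD : IsFilter P F D) (S : Asm P) :
    (realization hD).obj S ⟶ F.obj S.X := (realized F D S).arrow

instance (hD : IsFilter P F D) (S : Asm P) : Mono (realizationι hD S) :=
  inferInstanceAs (Mono (realized F D S).arrow)

theorem realization_map_ι (hD : IsFilter P F D) {S T : Asm P} (f : S ⟶ T) :
    (realization hD).map f ≫ realizationι hD T = realizationι hD S ≫ F.map f.1 :=
  Subobject.factorThru_arrow _ _ (realized_map hD f.2 (Subobject.factors_self _))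

theorem realized_factors_iff_exists (hD : IsFilter P F D) {S : Asm P} {K : C}
    {x : K ⟶ F.obj S.X} : (realized F D S).Factors x ↔
      ∃ z : K ⟶ (realization hD).obj S, z ≫ realizationι hD S = x :=
  factors_iff_exists

theorem isPullback_realization (hD : IsFilter P F D) {S T R : Asm P} {f : S ⟶ R} {g : T ⟶ R}
    {X : E} {u : X ⟶ S.X} {v : X ⟶ T.X} (h : IsPullback u v f.1 g.1) :
    IsPullback ((realization hD).map (Asm.meetFst u v)) ((realization hD).map (Asm.meetSnd u v))
      ((realization hD).map f) ((realization hD).map g) := by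
  have hF := h.map F
  have key (s : PullbackCone ((realization hD).map f) ((realization hD).map g)) :
      ∃ z, z ≫ (realization hD).map (Asm.meetFst u v) = s.fst ∧
        z ≫ (realization hD).map (Asm.meetSnd u v) = s.snd := by
    have e : (s.fst ≫ realizationι hD S) ≫ F.map f.1 =
        (s.snd ≫ realizationι hD T) ≫ F.map g.1 := by
      have := congrArg (· ≫ realizationι hD R) s.condition
      simpa only [Category.assoc, realization_map_ι] using this
    have he : (realized F D (S.meet T u v)).Factors (hF.lift _ _ e) :=
      realized_meet hD
        (by rw [hF.lift_fst]; exact (realized_factors_iff_exists hD).2 ⟨_, rfl⟩)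
        (by rw [hF.lift_snd]; exact (realized_factors_iff_exists hD).2 ⟨_, rfl⟩)
    obtain ⟨z, hz⟩ := (realized_factors_iff_exists hD).1 he
    refine ⟨z, ?_, ?_⟩
    · rw [← cancel_mono (realizationι hD S), Category.assoc, realization_map_ι,
        ← Category.assoc, hz]
      exact hF.lift_fst _ _ _
    · rw [← cancel_mono (realizationι hD T), Category.assoc, realization_map_ι,
        ← Category.assoc, hz]
      exact hF.lift_snd _ _ _
  choose z h₁ h₂ using key
  refine ⟨⟨by simp only [← Functor.map_comp, (Asm.isPullback_meet h).w]⟩,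
    ⟨PullbackCone.IsLimit.mk _ z h₁ h₂ fun s m k₁ k₂ => ?_⟩⟩
  rw [← cancel_mono (realizationι hD (S.meet T u v))]
  refine hF.hom_ext ?_ ?_
  · have := congrArg (· ≫ realizationι hD S) (k₁.trans (h₁ s).symm)
    simp only [Category.assoc, realization_map_ι] at this
    rw [Category.assoc, Category.assoc]
    exact this
  · have := congrArg (· ≫ realizationι hD T) (k₂.trans (h₂ s).symm)
    simp only [Category.assoc, realization_map_ι] at this
    rw [Category.assoc, Category.assoc]
    exact this

instance isIso_realizationι_nabla (hD : IsFilter P F D) (X : E) :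
    IsIso (realizationι hD ((nabla P).obj X)) :=
  (Subobject.isIso_iff_mk_eq_top _).2 (by
    change Subobject.mk (realized F D _).arrow = ⊤
    rw [Subobject.mk_arrow, realized_nabla hD])

theorem strongEpi_realization_map (hD : IsFilter P F D) {S T : Asm P} {f : S ⟶ T}
    (hf : Asm.IsCover f) : StrongEpi ((realization hD).map f) := by
  obtain ⟨_, hT⟩ := hf
  have hx : (realized F D (S.push f.1)).Factors (realizationι hD T ≫ F.map (𝟙 T.X)) :=
    realized_map hD hT ((realized_factors_iff_exists hD).2 ⟨𝟙 _, Category.id_comp _⟩)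
  obtain ⟨J, q, r, _, hr, h⟩ := realized_factors_iff.1 hx
  obtain ⟨I, p, y, _, hy, hS⟩ := Asm.push_factors_iff.1 (factors_lift_self (S.push f.1).Y)
  have := RegularFunctor.map_strongEpi F p
  obtain ⟨L, j, k, _, hk⟩ := exists_cover_lift (F.map p) r
  obtain ⟨z, hz⟩ := (realized_factors_iff_exists hD).1 (realized_of_map k hS (D := D) (by
    rw [F.map_comp, ← Category.assoc, hk, Category.assoc]
    exact factors_comp hr j))
  have : StrongEpi (j ≫ q) := strongEpi_comp _ _
  refine strongEpi_of_lift _ (j ≫ q) z ?_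
  have e₁ : (k ≫ F.map y) ≫ F.map f.1 =
      k ≫ F.map p ≫ F.map ((S.push f.1).Y.arrow ≫ prod.snd) := by
    rw [Category.assoc, ← F.map_comp, hy, F.map_comp]
  have e₂ : (j ≫ q) ≫ realizationι hD T =
      j ≫ r ≫ F.map ((S.push f.1).Y.arrow ≫ prod.snd) := by
    rw [h, F.map_id, Category.comp_id, Category.assoc]
  rw [← cancel_mono (realizationι hD T), Category.assoc, realization_map_ι, ← Category.assoc, hz,
    e₂, ← Category.assoc j, ← hk]
  exact e₁.trans (Category.assoc _ _ _).symm

instance realization_regularFunctor (hD : IsFilter P F D) : RegularFunctor (realization hD) where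
  toPreservesFiniteLimits := by
    have : PreservesLimit (Functor.empty.{0} (Asm P)) (realization hD) := by
      refine preservesTerminal_of_iso _ ?_
      exact (realization hD).mapIso (terminalIsTerminal.uniqueUpToIso Asm.isTerminalNabla) ≪≫
        asIso (realizationι hD ((nabla P).obj (⊤_ E))) ≪≫
          (IsTerminal.isTerminalObj F _ terminalIsTerminal).uniqueUpToIso terminalIsTerminal
    have := preservesLimitsOfShape_pempty_of_preservesTerminal (realization hD)
    have : PreservesLimitsOfShape WalkingCospan (realization hD) := by
      refine ⟨fun {K} => ?_⟩
      have : PreservesLimit (cospan (K.map WalkingCospan.Hom.inl) (K.map WalkingCospan.Hom.inr))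
          (realization hD) := by
        have h := IsPullback.of_hasPullback (K.map WalkingCospan.Hom.inl).1
          (K.map WalkingCospan.Hom.inr).1
        exact preservesLimit_of_preserves_limit_cone (Asm.isPullback_meet h).isLimit
          ((isLimitMapConePullbackConeEquiv _ (Asm.isPullback_meet h).w).symm (isPullback_realization hD h).isLimit)
      exact preservesLimit_of_iso_diagram _ (diagramIsoCospan K).symm
    exact preservesFiniteLimits_of_preservesTerminal_and_pullbacks _
  map_regularEpi f _ := by
    have := strongEpi_realization_map hD (Asm.isCover_of_strongEpi f)
    exact isRegularEpi_of_strongEpi _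

/-- `F_D ∇ ≅ F`. -/
noncomputable def nablaRealizationIso (hD : IsFilter P F D) : nabla P ⋙ realization hD ≅ F :=
  NatIso.ofComponents (fun X => @asIso C _ _ _ (realizationι hD ((nabla P).obj X)) (isIso_realizationι_nabla hD X))
    (fun f => realization_map_ι hD ((nabla P).map f))

theorem mk_realization_ring (hD : IsFilter P F D) :
    Subobject.mk ((realization hD).map (ring P).arrow ≫
      (nablaRealizationIso hD).hom.app P.A.carrier) = D := by
  rw [mk_map_ring_arrow]
  have e : (realization hD).map (ringι P) ≫ (nablaRealizationIso hD).hom.app P.A.carrier =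
      realizationι hD (ringAsm P) :=
    (realization_map_ι hD (ringι P)).trans
      ((congrArg _ (F.map_id P.A.carrier)).trans (Category.comp_id _))
  refine subobject_ext fun K x => ?_
  rw [mk_factors_iff', e]
  exact (realized_factors_iff_exists (S := ringAsm P) hD).symm.trans
    (iff_of_eq (congrArg (fun U : Subobject (F.obj P.A.carrier) => U.Factors x)
      (realized_ringAsm hD)))

end Realization

namespace Asm

/-- The inclusion of an assembly into `∇` of its underlying object. -/
noncomputable def toNabla (S : Asm P) : S ⟶ (nabla P).obj S.X := ⟨𝟙 S.X, isTracked_top _⟩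

instance (S : Asm P) : Mono S.toNabla where
  right_cancellation f g h := hom_ext ((Category.comp_id f.1).symm.trans
    ((congrArg Subtype.val h : f.1 ≫ 𝟙 S.X = g.1 ≫ 𝟙 S.X).trans (Category.comp_id g.1)))

theorem toNabla_naturality {S T : Asm P} (f : S ⟶ T) :
    f ≫ T.toNabla = S.toNabla ≫ (nabla P).map f.1 :=
  hom_ext ((Category.comp_id f.1).trans (Category.id_comp f.1).symm)

/-- The object `Y` of an assembly `(X, Y)`, in which `(b, x)` is realized by the `a ≤ b`. -/
noncomputable abbrev graph (S : Asm P) : Asm P := (ringAsm P).reindex (S.Y.arrow ≫ prod.fst)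

noncomputable def graphToRing (S : Asm P) : S.graph ⟶ ringAsm P :=
  ⟨S.Y.arrow ≫ prod.fst, isTracked_of_le _ _ _ fun _ _ _ h => reindex_factors_iff.1 h⟩

noncomputable def graphTo (S : Asm P) : S.graph ⟶ S :=
  ⟨S.Y.arrow ≫ prod.snd, isTracked_of_le _ _ _ fun _ _ x h =>
    S.down _ _ _ (factors_lift_comp (factors_lift_self S.Y) x) (reindex_factors_iff.1 h)⟩

theorem isCover_graphTo (S : Asm P) : IsCover S.graphTo := by
  have hS := S.total
  have : StrongEpi (S.Y.arrow ≫ prod.snd) := inferInstance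
  have key : IsTracked S (S.graph.push (S.Y.arrow ≫ prod.snd)) (𝟙 S.X) := by
    refine isTracked_of_le _ _ _ fun I b x h => ?_
    obtain ⟨r, hr, hr'⟩ := factors_lift_iff.1 h
    refine push_factors_iff.2 ⟨I, 𝟙 I, r, inferInstance, ?_, reindex_factors_iff.2 ?_⟩
    · rw [hr', Category.id_comp, Category.comp_id]
    · rw [Category.id_comp]
      have := P.A.le_refl b
      rw [← hr] at this ⊢
      exact this
  exact ⟨this, key⟩

theorem isPullback_graph (S : Asm P) : IsPullback S.graphToRing S.graph.toNabla (ringι P)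
    ((nabla P).map (S.Y.arrow ≫ prod.fst)) :=
  ⟨⟨hom_ext ((Category.comp_id _).trans (Category.id_comp _).symm)⟩,
    ⟨PullbackCone.IsLimit.mk _
      (fun s => ⟨s.snd.1, by
        have h : s.fst.1 = s.snd.1 ≫ S.Y.arrow ≫ prod.fst :=
          (Category.comp_id s.fst.1).symm.trans (congrArg Subtype.val s.condition)
        obtain ⟨V, hV, tV⟩ := s.fst.2
        refine ⟨V, hV, fun I a b x ha hb => ?_⟩
        obtain ⟨c, hc, hT⟩ := tV a b x ha hb
        rw [h] at hT
        exact ⟨c, hc, reindex_factors_iff.2 ((Category.assoc x s.snd.1 _).symm ▸ hT)⟩⟩)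
      (fun s => hom_ext ((congrArg Subtype.val s.condition).symm.trans (Category.comp_id s.fst.1)))
      (fun s => hom_ext (Category.comp_id s.snd.1))
      (fun s m _ h => hom_ext ((Category.comp_id m.1).symm.trans (congrArg Subtype.val h)))⟩⟩

end Asm

section Comparison

variable {C : Type u₁} [Category.{v₁} C] {F : E ⥤ C} {H : Asm P ⥤ C}
  (η : nabla P ⋙ H ≅ F)

/-- The arrow `H (X, Y) ⟶ H ∇ X ≅ F X`. -/
noncomputable def comparison (S : Asm P) : H.obj S ⟶ F.obj S.X :=
  H.map S.toNabla ≫ η.hom.app S.X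

instance [PreservesFiniteLimits H] (S : Asm P) : Mono (comparison η S) :=
  inferInstanceAs (Mono (H.map S.toNabla ≫ η.hom.app S.X))

theorem comparison_naturality {S T : Asm P} (f : S ⟶ T) :
    H.map f ≫ comparison η T = comparison η S ≫ F.map f.1 := by
  have h := η.hom.naturality f.1
  dsimp only [Functor.comp_map] at h
  rw [comparison, comparison, ← Category.assoc, ← H.map_comp, toNabla_naturality, H.map_comp,
    Category.assoc, Category.assoc]
  exact congrArg (H.map S.toNabla ≫ ·) h

theorem comparison_nabla (X : E) : comparison η ((nabla P).obj X) = η.hom.app X :=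
  (congrArg (· ≫ η.hom.app X) (H.map_id ((nabla P).obj X))).trans (Category.id_comp _)

/-- A functor that extends `F` and sends `Å` to the filter `D` sends an assembly to the object of
elements that have a realizer in `D`. -/
theorem mk_comparison [Regular C] [RegularFunctor H] {D : Subobject (F.obj P.A.carrier)}
    (hD : Subobject.mk (H.map (ring P).arrow ≫ η.hom.app P.A.carrier) = D) (S : Asm P) :
    Subobject.mk (comparison η S) = realized F D S := by
  rw [mk_map_ring_arrow] at hD
  have hD' {K : C} (x : K ⟶ F.obj P.A.carrier) :
      D.Factors x ↔ ∃ d, d ≫ comparison η (ringAsm P) = x := by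
    rw [← hD]
    exact mk_factors_iff' _ _
  refine subobject_ext fun K x => ?_
  rw [mk_factors_iff', realized_factors_iff]
  constructor
  · rintro ⟨h, rfl⟩
    have : IsRegularEpi S.graphTo := isRegularEpi_of_isCover S.isCover_graphTo
    have := RegularFunctor.map_strongEpi H S.graphTo
    obtain ⟨J, q, g, hq, hg⟩ := exists_cover_lift (H.map S.graphTo) h
    refine ⟨J, q, g ≫ comparison η S.graph, hq, (hD' _).2 ⟨g ≫ H.map S.graphToRing, ?_⟩, ?_⟩
    · rw [Category.assoc, Category.assoc]
      exact congrArg (g ≫ ·) (comparison_naturality η S.graphToRing)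
    · rw [← Category.assoc, ← hg, Category.assoc, Category.assoc]
      exact congrArg (g ≫ ·) (comparison_naturality η S.graphTo).symm
  · rintro ⟨J, q, r, _, hr, h⟩
    obtain ⟨d, hd⟩ := (hD' _).1 hr
    have hd' : d ≫ H.map (ringι P) ≫ η.hom.app P.A.carrier =
        r ≫ F.map (S.Y.arrow ≫ prod.fst) := hd
    have sq := S.isPullback_graph.map H
    have e : d ≫ H.map (ringι P) =
        (r ≫ η.inv.app (S.Y : E)) ≫ H.map ((nabla P).map (S.Y.arrow ≫ prod.fst)) := by
      have := η.inv.naturality (S.Y.arrow ≫ prod.fst)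
      dsimp only [Functor.comp_map] at this
      rw [Category.assoc, ← this, ← Category.assoc, ← hd']
      simp
    have hg : sq.lift _ _ e ≫ comparison η S.graph = r := by
      rw [comparison, ← Category.assoc, sq.lift_snd]
      simp
    have key : (Subobject.mk (comparison η S)).Factors (q ≫ x) := by
      refine (mk_factors_iff' _ _).2 ⟨sq.lift _ _ e ≫ H.map S.graphTo, ?_⟩
      rw [Category.assoc, comparison_naturality, ← Category.assoc, hg]
      exact h
    exact (mk_factors_iff' _ _).1 (factors_of_cover q key)

theorem existsUnique_iso [Regular C] [RegularFunctor H] {H' : Asm P ⥤ C} [RegularFunctor H']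
    (η' : nabla P ⋙ H' ≅ F)
    (h : Subobject.mk (H.map (ring P).arrow ≫ η.hom.app P.A.carrier) =
      Subobject.mk (H'.map (ring P).arrow ≫ η'.hom.app P.A.carrier)) :
    ∃! θ : H ≅ H', ∀ X : E, θ.hom.app ((nabla P).obj X) ≫ η'.hom.app X = η.hom.app X := by
  have hS (S : Asm P) : Subobject.mk (comparison η S) = Subobject.mk (comparison η' S) := by
    rw [mk_comparison η rfl, mk_comparison η' rfl, h]
  have hι (S : Asm P) : (Subobject.isoOfMkEqMk _ _ (hS S)).hom ≫ comparison η' S =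
      comparison η S := Subobject.ofMkLEMk_comp _
  refine ⟨NatIso.ofComponents (fun S => Subobject.isoOfMkEqMk _ _ (hS S)) fun {S T} f => ?_,
    fun X => ?_, fun θ hθ => ?_⟩
  · rw [← cancel_mono (comparison η' T), Category.assoc, Category.assoc, hι,
      comparison_naturality, comparison_naturality, ← Category.assoc, hι]
  · exact (congrArg ((Subobject.isoOfMkEqMk _ _ (hS ((nabla P).obj X))).hom ≫ ·)
      (comparison_nabla η' X)).symm.trans ((hι _).trans (comparison_nabla η X))
  · ext S
    rw [← cancel_mono (comparison η' S)]
    refine Eq.trans ?_ (hι S).symm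
    rw [comparison, comparison, ← Category.assoc, ← θ.hom.naturality, Category.assoc, hθ]

end Comparison

end RelReal

theorem mainTheorem1 {E : Type u} [Category.{v} E] [RelReal.HeytingCategory E]
    (P : RelReal.OPCAPair E) :
    ∃ (_ : Regular (RelReal.Asm P)) (_ : RelReal.RegularFunctor (RelReal.nabla P))
      (hF : RelReal.IsFilter P (RelReal.nabla P) (RelReal.ring P)),
      RelReal.RegularModel.IsPseudoinitial.{v, u, v, max u v, v₂, u₂}
        { C := RelReal.Asm P, F := RelReal.nabla P, filter := RelReal.ring P, isFilter := hF } :=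
  ⟨inferInstance, inferInstance, RelReal.ring_isFilter P, fun N =>
    ⟨⟨{ H := RelReal.realization N.isFilter
        η := RelReal.nablaRealizationIso N.isFilter
        map_filter := RelReal.mk_realization_ring N.isFilter }⟩, fun K L =>
      have := K.regularFunctor
      have := L.regularFunctor
      RelReal.existsUnique_iso K.η L.η (K.map_filter.trans L.map_filter.symm)⟩⟩
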